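/- Let $\Bbbk$ be a field of characteristic zero and let $(R,\mathfrak m)$ be a Noetherian local $\Bbbk$-algebra with $\dim R>0$. For $m,n\ge 1$ the group $G_{lr}=GL(m,R)\times GL(n,R)$ acts on $Mat(m,n;R)$ by $A\mapsto UAV$, and $G_r=GL(n,R)$ acts by $A\mapsto AV$. For $G\in\{G_r,G_{lr}\}$ a matrix $A$ is called finitely $G$-determined if there is $d\in\mathbb N$ such that $A+B\in GA$ for all $B\in Mat(m,n;\mathfrak m^{d+1})$. For a $\Bbbk$-subspace $E\subseteq Mat(m,n;R)$, a subset $S\subseteq E$ is said to be of infinite codimension in $E$ if, writing $E_k\subseteq Mat(m,n;R/\mathfrak m^k)$ for the image of $E$, the codimension in the affine space $E_k$ (over $\Bbbk$) of the Zariski closure of the image of $S$ tends to infinity with $k$. 1. Let $A\in Mat(m,m;\mathfrak m)$. Then $A$ is finitely $G_{lr}$-determined if and only if $\dim R=1$ and the image of $\det A$ in $R_{red}=R/\mathrm{Nilp}(R)$ is a nonzerodivisor. If moreover $\dim R\neq 1$ or $\mathfrak m$ contains a nonzerodivisor of $R$, then $A$ is finitely $G_{lr}$-determined if and only if $\dim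 R=1$ and $\det A$ is a nonzerodivisor of $R$. 2. If $\dim R>|n-m|+1$, then no matrix in $Mat(m,n;\mathfrak m)$ is finitely $G_{lr}$-determined. 3. Suppose that $R/\mathfrak m$ is finite over $\Bbbk$ (for instance $R/\mathfrak m=\Bbbk$), $m\le n$ and $\dim R\le |n-m|+1$. Then for every $A\in Mat(m,n;R)$ and every $N>0$ the set of those $B\in Mat(m,n;\mathfrak m^N)$ for which $A+B$ is not finitely $G_r$-determined is of infinite codimension in $Mat(m,n;\mathfrak m^N)$. Moreover, the set of matrices that are not finitely $G_r$-determined is of infinite codimension in $Mat(m,n;R)$. 4. Suppose that $\dim R=2$ and $m\le n$, and let $\Delta_1,\Delta_2$ be the determinants of two distinct $m\times m$ blocks of $A\in Mat(m,n;R)$. If no prime ideal of height at most one contains both $\Delta_1$ and $\Delta_2$, then $A$ is finitely $G_r$-determined. In particular, if $R$ is factorial and $\Delta_1,\Delta_2$ are relatively prime (every common divisor of them is invertible), then $A$ is finitely $G_r$-determined. -/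

import Mathlib

noncomputable section

open IsLocalRing Matrix

/-- The orbit relation of the two-sided multiplications `A ↦ U A V`, the group being
`GL(m, R) × GL(n, R)` acting on `m × n` matrices. -/
def GlrEquiv {R : Type*} [CommRing R] {m n : ℕ} (A A' : Matrix (Fin m) (Fin n) R) : Prop :=
  ∃ (U : GL (Fin m) R) (V : GL (Fin n) R),
    A' = (U : Matrix (Fin m) (Fin m) R) * A * (V : Matrix (Fin n) (Fin n) R)

/-- The orbit relation of the right multiplications `A ↦ A V`, with `V ∈ GL(n, R)`. -/
def GrEquiv {R : Type*} [CommRing R] {m n : ℕ} (A A' : Matrix (Fin m) (Fin n) R) : Prop :=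
  ∃ V : GL (Fin n) R, A' = A * (V : Matrix (Fin n) (Fin n) R)

/-- `A` is `d`-determined for the equivalence `rel`: adding to `A` any matrix with entries
in `𝔪 ^ (d + 1)` does not change its equivalence class. -/
def IsDetermined {R : Type*} [CommRing R] [IsLocalRing R] {m n : ℕ}
    (rel : Matrix (Fin m) (Fin n) R → Matrix (Fin m) (Fin n) R → Prop) (d : ℕ)
    (A : Matrix (Fin m) (Fin n) R) : Prop :=
  ∀ B : Matrix (Fin m) (Fin n) R, (∀ i j, B i j ∈ maximalIdeal R ^ (d + 1)) → rel A (A + B)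

def IsFinitelyDetermined {R : Type*} [CommRing R] [IsLocalRing R] {m n : ℕ}
    (rel : Matrix (Fin m) (Fin n) R → Matrix (Fin m) (Fin n) R → Prop)
    (A : Matrix (Fin m) (Fin n) R) : Prop :=
  ∃ d : ℕ, IsDetermined rel d A

/-- The codimension of (the Zariski closure of) a subset `S` of the affine space underlying
a finite-dimensional `K`-vector space `V`: the height of the ideal of all polynomials, in linear
coordinates on `V`, that vanish on `S`. It is `⊤` for the empty set. -/
def zariskiCodim (K : Type*) {V : Type*} [Field K] [AddCommGroup V] [Module K V]
    (S : Set V) : ℕ∞ :=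
  (MvPolynomial.vanishingIdeal K
    ((fun v i => (Module.Basis.ofVectorSpace K V).repr v i) '' S)).height

/-- Reduction of the entries of a matrix modulo `𝔪 ^ k`. -/
def matrixJet (K : Type*) {R : Type*} [Field K] [CommRing R] [IsLocalRing R] [Algebra K R]
    (m n k : ℕ) :
    Matrix (Fin m) (Fin n) R →ₗ[K] Matrix (Fin m) (Fin n) (R ⧸ maximalIdeal R ^ k) :=
  (Ideal.Quotient.mkₐ K (maximalIdeal R ^ k)).toLinearMap.mapMatrix

/-- The space of `m × n` matrices with entries in the ideal `I`, as a `K`-vector space. -/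
def matricesIn (K : Type*) {R : Type*} [Field K] [CommRing R] [Algebra K R]
    (m n : ℕ) (I : Ideal R) : Submodule K (Matrix (Fin m) (Fin n) R) where
  carrier := {B | ∀ i j, B i j ∈ I}
  add_mem' hA hB i j := I.add_mem (hA i j) (hB i j)
  zero_mem' _ _ := I.zero_mem
  smul_mem' c B hB i j := by
    rw [Matrix.smul_apply, Algebra.smul_def]
    exact I.mul_mem_left _ (hB i j)

/-- A set `S` of matrices in the `K`-vector space `E` is of infinite codimension in `E`:
the sets of the reductions modulo `𝔪 ^ k` of its elements lie in Zariski closed subsets of the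
spaces of all reductions modulo `𝔪 ^ k` of elements of `E`, whose codimensions tend to infinity
with `k`. -/
def HasInfiniteCodim (K : Type*) {R : Type*} [Field K] [CommRing R] [IsLocalRing R]
    [Algebra K R] {m n : ℕ} (E : Submodule K (Matrix (Fin m) (Fin n) R))
    (S : Set (Matrix (Fin m) (Fin n) R)) : Prop :=
  ∀ c : ℕ, ∃ k₀ : ℕ, ∀ k ≥ k₀,
    (c : ℕ∞) ≤ zariskiCodim K
      {x : E.map (matrixJet K m n k) | ∃ B ∈ E, B ∈ S ∧ matrixJet K m n k B = x}

end

universe u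

open IsLocalRing Matrix

/-! Everything is read off from the ideal `I` of maximal minors. If `I` contains `𝔪 ^ N`, Cramer's
rule puts `𝔪 ^ N R^m` inside the column space of `A`; a perturbation with entries in `𝔪 ^ (N + 1)`
is then `A V` with `V ≡ 0` modulo `𝔪`, and `A + A V = A (1 + V)` with `1 + V` invertible
(`isFinitelyDetermined_of_range`). Conversely, let `m ≤ n`. The ideal `I` is invariant along
two-sided orbits. If a prime `P ≠ 𝔪` contained `I`, adding high powers of some `t ∈ 𝔪 \ P` times an
identity block would give a characteristic polynomial over `R / P` infinitely many roots
(`eq_maximalIdeal_of_isFinitelyDetermined`). With the Eagon–Northcott bound `n - m + 1` on heights,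
this settles the square case and the case of large dimension; coprime minors only need the first
criterion. For genericity, Nakayama shows that a matrix that is not finitely determined has corank
at least `k` on `k`-jets, while a banded matrix `X` made of powers of parameters has bounded corank.
Hence a determinant that is monic in the direction `X` vanishes on the bad jets. As `X` can be
chosen invisible to lower jets, the codimension can be raised by one again and again
(`hasInfiniteCodim_of_exists`). -/

/-- The ideal generated by the maximal minors of an `m × n` matrix. -/
def minorIdeal {R : Type*} [CommRing R] {m n : ℕ} (A : Matrix (Fin m) (Fin n) R) : Ideal R :=
  Ideal.span (Set.range fun f : Fin m → Fin n => (A.submatrix id f).det)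

/-! ### Ideals of maximal minors: invariance and pivoting. -/

section minorIdeal

variable {R S : Type*} [CommRing R] [CommRing S] {m n : ℕ}

theorem det_submatrix_mem_minorIdeal (A : Matrix (Fin m) (Fin n) R) (f : Fin m → Fin n) :
    (A.submatrix id f).det ∈ minorIdeal A :=
  Ideal.subset_span ⟨f, rfl⟩

theorem minorIdeal_le_iff {A : Matrix (Fin m) (Fin n) R} {I : Ideal R} :
    minorIdeal A ≤ I ↔ ∀ f : Fin m → Fin n, (A.submatrix id f).det ∈ I := by
  rw [minorIdeal, Ideal.span_le, Set.range_subset_iff]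
  rfl

theorem map_minorIdeal (φ : R →+* S) (A : Matrix (Fin m) (Fin n) R) :
    (minorIdeal A).map φ = minorIdeal (A.map φ) := by
  rw [minorIdeal, minorIdeal, Ideal.map_span, ← Set.range_comp]
  congr 2
  funext f
  rw [Function.comp_apply, RingHom.map_det]
  rfl

theorem minorIdeal_submatrix_equiv_le (A : Matrix (Fin m) (Fin n) R) (σ : Equiv.Perm (Fin m))
    (τ : Fin n → Fin n) : minorIdeal (A.submatrix σ τ) ≤ minorIdeal A := by
  rw [minorIdeal_le_iff]
  intro f
  have : (A.submatrix σ τ).submatrix id f = (A.submatrix id (τ ∘ f)).submatrix σ id := rfl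
  rw [this, Matrix.det_permute]
  exact Ideal.mul_mem_left _ _ (det_submatrix_mem_minorIdeal _ _)

theorem minorIdeal_submatrix_equiv (A : Matrix (Fin m) (Fin n) R) (σ : Equiv.Perm (Fin m))
    (τ : Equiv.Perm (Fin n)) : minorIdeal (A.submatrix σ τ) = minorIdeal A := by
  refine le_antisymm (minorIdeal_submatrix_equiv_le A σ τ) ?_
  have := minorIdeal_submatrix_equiv_le (A.submatrix σ τ) σ⁻¹ (τ⁻¹ : Equiv.Perm (Fin n))
  rwa [Matrix.submatrix_submatrix, ← Equiv.Perm.coe_mul, ← Equiv.Perm.coe_mul, mul_inv_cancel,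
    mul_inv_cancel, Equiv.Perm.coe_one, Equiv.Perm.coe_one, Matrix.submatrix_id_id] at this

/-- A linear combination of the columns of a matrix has maximal minors in the ideal generated by
those of the matrix. -/
theorem minorIdeal_mul_right_le {l : ℕ} (A : Matrix (Fin m) (Fin n) R)
    (V : Matrix (Fin n) (Fin l) R) : minorIdeal (A * V) ≤ minorIdeal A := by
  classical
  rw [minorIdeal_le_iff]
  intro f
  rw [← Matrix.det_transpose]
  have h : ((A * V).submatrix id f)ᵀ = fun i => ∑ j, V j (f i) • Aᵀ j := by
    funext i k
    simp [Matrix.mul_apply, mul_comm]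
  -- Multilinear expansion over all choices of columns of `A`, repetitions included; this is why
  -- `minorIdeal` ranges over all functions.
  have := (Matrix.detRowAlternating (n := Fin m) (R := R)).toMultilinearMap.map_sum
    (fun i j => V j (f i) • Aᵀ j)
  rw [h]
  refine (congrArg (· ∈ minorIdeal A) this).mpr ?_
  refine Ideal.sum_mem _ fun r _ => ?_
  rw [MultilinearMap.map_smul_univ]
  refine Ideal.mul_mem_left _ _ ?_
  have h2 : (A.submatrix id r).det ∈ minorIdeal A := det_submatrix_mem_minorIdeal A r
  rw [← Matrix.det_transpose] at h2
  exact h2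

theorem minorIdeal_mul_left_le (U : Matrix (Fin m) (Fin m) R) (A : Matrix (Fin m) (Fin n) R) :
    minorIdeal (U * A) ≤ minorIdeal A := by
  rw [minorIdeal_le_iff]
  intro f
  have : (U * A).submatrix id f = U * A.submatrix id f := rfl
  rw [this, Matrix.det_mul]
  exact Ideal.mul_mem_left _ _ (det_submatrix_mem_minorIdeal _ _)

theorem minorIdeal_eq_of_row_add (A N : Matrix (Fin m) (Fin n) R) (c : Fin m → R) (k : Fin m)
    (hk : c k = 0) (h : ∀ i j, N i j = A i j + c i * A k j) : minorIdeal N = minorIdeal A := by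
  rw [minorIdeal, minorIdeal]
  congr 2
  funext f
  exact Matrix.det_eq_of_forall_row_eq_smul_add_const c k hk fun i j => h i (f j)

theorem minorIdeal_of_column_zero (N : Matrix (Fin (m + 1)) (Fin (n + 1)) R)
    (h0 : IsUnit (N 0 0)) (h : ∀ i : Fin m, N i.succ 0 = 0) :
    minorIdeal N = minorIdeal (N.submatrix Fin.succ Fin.succ) := by
  apply le_antisymm
  · rw [minorIdeal_le_iff]
    intro g
    rw [Matrix.det_succ_row_zero]
    refine Ideal.sum_mem _ fun j _ => Ideal.mul_mem_left _ _ ?_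
    by_cases hz : ∃ k, g (j.succAbove k) = 0
    · obtain ⟨k, hk⟩ := hz
      rw [Matrix.det_eq_zero_of_column_eq_zero k]
      · exact Ideal.zero_mem _
      · intro i
        simp [hk, h]
    · push Not at hz
      have : (N.submatrix id g).submatrix Fin.succ j.succAbove =
          (N.submatrix Fin.succ Fin.succ).submatrix id fun k => (g (j.succAbove k)).pred (hz k) := by
        ext a b
        simp
      rw [this]
      exact det_submatrix_mem_minorIdeal _ _
  · rw [minorIdeal_le_iff]
    intro f
    have h1 := det_submatrix_mem_minorIdeal N (Fin.cons 0 (Fin.succ ∘ f) : Fin (m + 1) → Fin (n + 1))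
    rw [Matrix.det_succ_column_zero, Finset.sum_eq_single 0] at h1
    · simp only [Fin.val_zero, pow_zero, one_mul, Matrix.submatrix_apply, id_eq, Fin.cons_zero] at h1
      rw [Ideal.unit_mul_mem_iff_mem _ h0] at h1
      exact h1
    · intro b _ hb
      obtain ⟨b, rfl⟩ := Fin.exists_succ_eq_of_ne_zero hb
      simp [h]
    · simp

theorem exists_minorIdeal_eq_of_isUnit (A : Matrix (Fin (m + 1)) (Fin (n + 1)) R)
    (h0 : IsUnit (A 0 0)) : ∃ A' : Matrix (Fin m) (Fin n) R, minorIdeal A = minorIdeal A' := by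
  obtain ⟨u, hu⟩ := h0
  let c : Fin (m + 1) → R := Fin.cons 0 fun i => -(A i.succ 0 * ↑u⁻¹)
  let N : Matrix (Fin (m + 1)) (Fin (n + 1)) R := Matrix.of fun i j => A i j + c i * A 0 j
  have hN : minorIdeal N = minorIdeal A := minorIdeal_eq_of_row_add A N c 0 rfl fun _ _ => rfl
  refine ⟨N.submatrix Fin.succ Fin.succ, hN.symm.trans (minorIdeal_of_column_zero N ?_ ?_)⟩
  · simp [N, c, ← hu]
  · intro i
    simp [N, c, ← hu, mul_assoc]

end minorIdeal

/-! ### The Eagon–Northcott height bound. -/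

section height

/-- The minimal primes of ideals of maximal minors have height at most `c`, for matrices of a
given size over all Noetherian rings of a universe. -/
def MinorHeightLE (m n c : ℕ) : Prop :=
  ∀ (R : Type*) [CommRing R] [IsNoetherianRing R] (A : Matrix (Fin m) (Fin n) R) (P : Ideal R),
    P ∈ (minorIdeal A).minimalPrimes → P.height ≤ c

/-- Localizing at `P` keeps its height and makes the corner entry a unit; clearing its column then
leaves a smaller matrix with the same ideal of minors and the same `n - m`. -/
theorem MinorHeightLE.of_pivot {m n c : ℕ} (ih : MinorHeightLE.{u} m n c) {R : Type u} [CommRing R]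
    [IsNoetherianRing R] (A : Matrix (Fin (m + 1)) (Fin (n + 1)) R) (P : Ideal R)
    (hP : P ∈ (minorIdeal A).minimalPrimes) (h : A 0 0 ∉ P) : P.height ≤ c := by
  have hPp : P.IsPrime := hP.1.1
  let S := Localization.AtPrime P
  have hu : IsUnit ((A.map (algebraMap R S)) 0 0) :=
    (IsLocalization.AtPrime.isUnit_to_map_iff S P (A 0 0)).mpr h
  obtain ⟨A', hA'⟩ := exists_minorIdeal_eq_of_isUnit _ hu
  have hcomap : (maximalIdeal S).under R = P := IsLocalization.AtPrime.under_maximalIdeal S P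
  have hmin : maximalIdeal S ∈ (minorIdeal A').minimalPrimes := by
    rw [← hA', ← map_minorIdeal, IsLocalization.minimalPrimes_map P.primeCompl S]
    simpa [hcomap] using hP
  have := ih S A' _ hmin
  rwa [← IsLocalization.height_under P.primeCompl, hcomap] at this

-- Deforming the corner by `X` creates a pivot outside the prime even when all entries lie in `P`. A
-- prime `Q'` over the new minors and strictly inside `P R[X]` would make `T = P + (X)` minimal over
-- `Q' + (X)`, since setting `X = 0` recovers `A`. The chain `Q' < P R[X] < T` then contradicts
-- Krull's principal ideal theorem in `R[X] / Q'`.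
open Polynomial in
theorem mem_minimalPrimes_map_C {R : Type*} [CommRing R] [IsNoetherianRing R] {m n : ℕ}
    (A : Matrix (Fin (m + 2)) (Fin (n + 1)) R) (P : Ideal R)
    (hP : P ∈ (minorIdeal A).minimalPrimes) (h : ∀ i j, A i j ∈ P) :
    P.map C ∈ (minorIdeal (A.map C + Matrix.single 0 0 X)).minimalPrimes := by
  have hPp : P.IsPrime := hP.1.1
  set M := A.map C + Matrix.single 0 0 (X : R[X]) with hM
  have hQp : (P.map C).IsPrime := Ideal.isPrime_map_C_of_isPrime
  have hMQ : minorIdeal M ≤ P.map C := by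
    rw [minorIdeal_le_iff]
    intro f
    rw [← Ideal.Quotient.eq_zero_iff_mem, RingHom.map_det]
    -- The deformation does not touch row 1, which exists because there are at least two rows.
    apply Matrix.det_eq_zero_of_row_eq_zero 1
    intro j
    have h10 : (0 : Fin (m + 2)) ≠ 1 := by simp
    simp only [RingHom.mapMatrix_apply, Matrix.map_apply, Matrix.submatrix_apply, id_eq, hM,
      Matrix.add_apply, Matrix.single_apply, h10, false_and, if_false, add_zero]
    rw [Ideal.Quotient.eq_zero_iff_mem]
    exact Ideal.mem_map_of_mem _ (h _ _)
  refine ⟨⟨hQp, hMQ⟩, ?_⟩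
  rintro Q' ⟨hQ'p, hQ'⟩ hle
  let T : Ideal R[X] := P.comap constantCoeff
  have hT : T.IsPrime := Ideal.comap_isPrime _ _
  have hXT : (X : R[X]) ∈ T := by simp [T]
  have hQT : P.map C ≤ T := by
    rw [Ideal.map_le_iff_le_comap]
    intro x hx
    simpa [T] using hx
  have hTmin : T ∈ (Q' ⊔ Ideal.span {X}).minimalPrimes := by
    refine ⟨⟨hT, sup_le (hle.trans hQT) ((Ideal.span_singleton_le_iff_mem _).mpr hXT)⟩, ?_⟩
    rintro Z ⟨hZp, hZ⟩ hZT
    have hXZ : (X : R[X]) ∈ Z := hZ (Ideal.mem_sup_right (Ideal.mem_span_singleton_self _))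
    have hZA : minorIdeal A ≤ Z.comap C := by
      rw [minorIdeal_le_iff]
      intro f
      have h1 : (M.submatrix id f).det ∈ Z :=
        hZ (Ideal.mem_sup_left (hQ' (det_submatrix_mem_minorIdeal _ _)))
      rw [Ideal.mem_comap, RingHom.map_det]
      rw [← Ideal.Quotient.eq_zero_iff_mem, RingHom.map_det] at h1 ⊢
      rw [← h1]
      congr 1
      ext i j
      by_cases hij : 0 = i ∧ 0 = f j
      · simp [hM, hij, Ideal.Quotient.eq_zero_iff_mem.mpr hXZ]
      · simp [hM, hij]
    have hZP : Z.comap C ≤ P := by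
      intro x hx
      have := hZT hx
      simpa [T] using this
    have hPZ : P ≤ Z.comap C := hP.2 ⟨Ideal.comap_isPrime _ _, hZA⟩ hZP
    intro p hp
    rw [← Polynomial.divX_mul_X_add p]
    refine Z.add_mem (Z.mul_mem_left _ hXZ) (hPZ ?_)
    simpa [T] using hp
  by_contra hne
  have hlt1 : Q' < P.map C := lt_of_le_not_ge hle hne
  have hlt2 : P.map C < T := by
    refine lt_of_le_not_ge hQT fun hc => ?_
    have := Ideal.mem_map_C_iff.mp (hc hXT) 1
    rw [coeff_X_one] at this
    exact hPp.ne_top ((Ideal.eq_top_iff_one _).mpr this)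
  have hht := Ideal.map_height_le_one_of_mem_minimalPrimes hTmin
  let q := Ideal.Quotient.mk Q'
  have hsurj : Function.Surjective q := Ideal.Quotient.mk_surjective
  have hcomap : ∀ J : Ideal R[X], Q' ≤ J → (J.map q).comap q = J := fun J hJ => by
    rw [Ideal.comap_map_of_surjective q hsurj, ← RingHom.ker_eq_comap_bot, Ideal.mk_ker,
      sup_eq_left.mpr hJ]
  have hp1 : ((P.map C).map q).IsPrime := Ideal.isPrime_map_quotientMk_of_isPrime hle
  have hp2 : (T.map q).IsPrime := Ideal.isPrime_map_quotientMk_of_isPrime (hle.trans hQT)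
  have hp0 : (Q'.map q).IsPrime := Ideal.isPrime_map_quotientMk_of_isPrime le_rfl
  have hlt : ∀ J₁ J₂ : Ideal R[X], Q' ≤ J₁ → J₁ < J₂ → J₁.map q < J₂.map q := by
    intro J₁ J₂ h1 h12
    refine lt_of_le_not_ge (Ideal.map_mono h12.le) fun hc => h12.not_ge ?_
    have := Ideal.comap_mono (f := q) hc
    rwa [hcomap _ h1, hcomap _ (h1.trans h12.le)] at this
  have e1 := Ideal.height_add_one_le_of_lt_of_isPrime (hlt _ _ le_rfl hlt1)
  have e2 := Ideal.height_add_one_le_of_lt_of_isPrime (hlt _ _ hle hlt2)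
  have e3 : (1 : ℕ∞) + 1 ≤ 1 := by
    calc (1 : ℕ∞) + 1 ≤ ((Q'.map q).height + 1) + 1 := by gcongr; exact le_add_self
      _ ≤ ((P.map C).map q).height + 1 := by gcongr
      _ ≤ _ := e2
      _ ≤ 1 := hht
  exact absurd e3 (by decide)

open Polynomial in
theorem height_le_height_map_C {R : Type*} [CommRing R] [IsNoetherianRing R] (P : Ideal R)
    [P.IsPrime] : P.height ≤ (P.map (C : R →+* R[X])).height := by
  have : (P.map (C : R →+* R[X])).LiesOver P := by
    refine ⟨le_antisymm Ideal.le_comap_map fun x hx => ?_⟩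
    simpa using Ideal.mem_map_C_iff.mp (Ideal.mem_comap.mp hx) 0
  rw [Ideal.height_eq_height_add_of_liesOver_of_hasGoingDown P (P.map C)]
  exact le_self_add

-- Induction on the number of rows with `n - m = k` fixed; one row is Krull's height theorem for `k
-- + 1` generators. An entry outside `P` is moved to the corner as a pivot; if there is none, the
-- pivot is `A 0 0 + X` over `R[X]`. These changes of ring are why the induction hypothesis
-- quantifies over rings.
open Polynomial in
theorem minorHeightLE_add (m k : ℕ) : MinorHeightLE.{u} (m + 1) (m + 1 + k) (k + 1) := by
  induction m with
  | zero =>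
    intro R _ _ A P hP
    refine (Ideal.height_le_card_of_mem_minimalPrimes_span (Set.finite_range _) hP).trans ?_
    refine Nat.cast_le.mpr ?_
    rw [← Set.image_univ]
    refine (Set.ncard_image_le Set.finite_univ).trans ?_
    simp [Set.ncard_univ, add_comm]
  | succ m ih =>
    have e : m + 1 + 1 + k = (m + 1 + k) + 1 := by omega
    rw [e]
    intro R _ _ A P hP
    have hPp : P.IsPrime := hP.1.1
    by_cases h : ∀ i j, A i j ∈ P
    · refine (height_le_height_map_C P).trans
        (MinorHeightLE.of_pivot ih _ _ (mem_minimalPrimes_map_C A P hP h) fun hc => ?_)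
      have := Ideal.mem_map_C_iff.mp hc 1
      simp at this
      exact hPp.ne_top ((Ideal.eq_top_iff_one _).mpr this)
    · push Not at h
      obtain ⟨i, j, hij⟩ := h
      refine MinorHeightLE.of_pivot ih (A.submatrix (Equiv.swap 0 i) (Equiv.swap 0 j)) P ?_ ?_
      · rwa [minorIdeal_submatrix_equiv]
      · simpa using hij

/-- The minimal primes of the ideal of maximal minors of an `m × n` matrix have height at most
`n - m + 1`. -/
theorem height_le_of_mem_minimalPrimes_minorIdeal {R : Type*} [CommRing R] [IsNoetherianRing R]
    {m n : ℕ} (hm : 1 ≤ m) (hmn : m ≤ n) (A : Matrix (Fin m) (Fin n) R) (P : Ideal R)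
    (hP : P ∈ (minorIdeal A).minimalPrimes) : P.height ≤ (n - m + 1 : ℕ) := by
  obtain ⟨m, rfl⟩ := Nat.exists_eq_add_of_le' hm
  obtain ⟨k, rfl⟩ := Nat.exists_eq_add_of_le hmn
  simpa using minorHeightLE_add m k R A P hP

end height

/-! ### Orbits, Cramer's rule and the reduced ring. -/

section equivalence

variable {R : Type*} [CommRing R] {m n : ℕ}

theorem GlrEquiv.of_grEquiv {A B : Matrix (Fin m) (Fin n) R} (h : GrEquiv A B) : GlrEquiv A B := by
  obtain ⟨V, hV⟩ := h
  exact ⟨1, V, by simpa using hV⟩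

/-- With `T` selecting columns, `(A T) adj(A T) = det(A T) 1`, so each minor times each unit vector
lies in the column space. -/
theorem exists_mulVec_eq_of_mem_minorIdeal (A : Matrix (Fin m) (Fin n) R) (v : Fin m → R)
    (hv : ∀ i, v i ∈ minorIdeal A) : ∃ w, A *ᵥ w = v := by
  have key : ∀ x ∈ minorIdeal A, ∀ i, Pi.single i x ∈ LinearMap.range A.mulVecLin := by
    intro x hx i
    induction hx using Submodule.span_induction with
    | mem x hx =>
      obtain ⟨f, rfl⟩ := hx
      let T : Matrix (Fin n) (Fin m) R := (1 : Matrix (Fin n) (Fin n) R).submatrix id f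
      have hT : A * T = A.submatrix id f := by
        ext i j
        simp [T, Matrix.mul_apply, Matrix.one_apply]
      refine ⟨(T * (A.submatrix id f).adjugate) *ᵥ Pi.single i 1, ?_⟩
      rw [Matrix.mulVecLin_apply, Matrix.mulVec_mulVec, ← Matrix.mul_assoc, hT,
        Matrix.mul_adjugate, Matrix.smul_mulVec, Matrix.one_mulVec, ← Pi.single_smul, smul_eq_mul,
        mul_one]
    | zero => simp
    | add x y _ _ hx hy => rw [Pi.single_add]; exact add_mem hx hy
    | smul a x _ hx => rw [Pi.single_smul]; exact Submodule.smul_mem _ _ hx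
  rw [← Finset.univ_sum_single v]
  exact sum_mem (S := LinearMap.range A.mulVecLin) fun i _ => key _ (hv i) i

theorem GlrEquiv.minorIdeal_le {A B : Matrix (Fin m) (Fin n) R} (h : GlrEquiv A B) :
    minorIdeal B ≤ minorIdeal A := by
  obtain ⟨U, V, rfl⟩ := h
  exact (minorIdeal_mul_right_le _ _).trans (minorIdeal_mul_left_le _ _)

theorem GlrEquiv.transpose {A B : Matrix (Fin m) (Fin n) R} (h : GlrEquiv A B) :
    GlrEquiv Aᵀ Bᵀ := by
  obtain ⟨U, V, rfl⟩ := h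
  refine ⟨⟨(V : Matrix (Fin n) (Fin n) R)ᵀ, ((V⁻¹ : GL _ R) : Matrix (Fin n) (Fin n) R)ᵀ, ?_, ?_⟩,
    ⟨(U : Matrix (Fin m) (Fin m) R)ᵀ, ((U⁻¹ : GL _ R) : Matrix (Fin m) (Fin m) R)ᵀ, ?_, ?_⟩, ?_⟩
  all_goals simp only [← Matrix.transpose_mul, Units.inv_mul, Units.mul_inv, Matrix.transpose_one]
  rw [Matrix.mul_assoc]

theorem minorIdeal_square (A : Matrix (Fin m) (Fin m) R) :
    minorIdeal A = Ideal.span {A.det} := by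
  apply le_antisymm
  · rw [minorIdeal_le_iff]
    intro f
    by_cases hf : Function.Injective f
    · have := minorIdeal_submatrix_equiv A 1
        (Equiv.ofBijective f (Finite.injective_iff_bijective.mp hf))
      have h1 : A.submatrix id f = A.submatrix id
        (Equiv.ofBijective f (Finite.injective_iff_bijective.mp hf)) := rfl
      rw [h1, Matrix.det_permute', Ideal.mem_span_singleton]
      exact dvd_mul_left _ _
    · rw [Function.not_injective_iff] at hf
      obtain ⟨a, b, hab, hne⟩ := hf
      have h0 : (A.submatrix id f).det = 0 :=
        Matrix.det_zero_of_column_eq hne fun i => congrArg (A i) hab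
      rw [h0]
      exact Ideal.zero_mem _
  · rw [Ideal.span_singleton_le_iff_mem]
    exact det_submatrix_mem_minorIdeal A id

theorem mem_nonZeroDivisors_quotient_nilradical_iff (x : R) :
    Ideal.Quotient.mk (nilradical R) x ∈ nonZeroDivisors (R ⧸ nilradical R) ↔
      ∀ P ∈ minimalPrimes R, x ∉ P := by
  constructor
  · intro h P hP hx
    have hPp : P.IsPrime := hP.1.1
    have hker : nilradical R ≤ P := nilradical_le_prime P
    have hdis : P.map (Ideal.Quotient.mk (nilradical R)) ∈ minimalPrimes (R ⧸ nilradical R) := by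
      refine ⟨⟨Ideal.isPrime_map_quotientMk_of_isPrime hker, bot_le⟩, ?_⟩
      rintro Q ⟨hQ, -⟩ hQP
      have hc := Ideal.comap_mono (f := Ideal.Quotient.mk (nilradical R)) hQP
      rw [Ideal.comap_map_of_surjective _ Ideal.Quotient.mk_surjective, ← RingHom.ker_eq_comap_bot,
        Ideal.mk_ker, sup_eq_left.mpr hker] at hc
      exact Ideal.map_le_iff_le_comap.mpr (hP.2 ⟨Ideal.comap_isPrime _ _, bot_le⟩ hc)
    exact Set.disjoint_left.mp (Ideal.disjoint_nonZeroDivisors_of_mem_minimalPrimes hdis)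
      (Ideal.mem_map_of_mem _ hx) h
  · intro h
    rw [mem_nonZeroDivisors_iff_right]
    intro y hy
    obtain ⟨y, rfl⟩ := Ideal.Quotient.mk_surjective y
    rw [← map_mul, Ideal.Quotient.eq_zero_iff_mem] at hy
    rw [Ideal.Quotient.eq_zero_iff_mem, nilradical, ← Ideal.sInf_minimalPrimes, Ideal.mem_sInf]
    intro P hP
    have hPp : P.IsPrime := hP.1.1
    exact (hPp.mem_or_mem (nilradical_le_prime P hy)).resolve_right (h P hP)

end equivalence

/-! ### Criteria for finite determinacy. -/

section determinacy

variable {R : Type*} [CommRing R] [IsLocalRing R] {m n : ℕ}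

/-- The additional factor from `𝔪` is moved to the preimage; this is what makes `1 + V` invertible
below. -/
theorem exists_mulVec_eq_of_mem_pow_succ {A : Matrix (Fin m) (Fin n) R} {N : ℕ}
    (h : ∀ v : Fin m → R, (∀ i, v i ∈ maximalIdeal R ^ N) → ∃ w, A *ᵥ w = v)
    (v : Fin m → R) (hv : ∀ i, v i ∈ maximalIdeal R ^ (N + 1)) :
    ∃ w, (∀ j, w j ∈ maximalIdeal R) ∧ A *ᵥ w = v := by
  have key : ∀ i, ∀ x ∈ maximalIdeal R * maximalIdeal R ^ N,
      ∃ w, (∀ j, w j ∈ maximalIdeal R) ∧ A *ᵥ w = Pi.single i x := by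
    intro i x hx
    induction hx using Submodule.mul_induction_on' with
    | mem_mul_mem a ha y hy =>
      obtain ⟨w, hw⟩ := h (Pi.single i y) fun k => by
        by_cases hk : k = i
        · subst hk; simpa using hy
        · simp [hk]
      refine ⟨a • w, fun j => Ideal.mul_mem_right _ _ ha, ?_⟩
      rw [Matrix.mulVec_smul, hw, ← Pi.single_smul, smul_eq_mul]
    | add x _ y _ hx hy =>
      obtain ⟨w, hw, hw'⟩ := hx
      obtain ⟨z, hz, hz'⟩ := hy
      refine ⟨w + z, fun j => Ideal.add_mem _ (hw j) (hz j), ?_⟩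
      rw [Matrix.mulVec_add, hw', hz', Pi.single_add]
  choose! w hw hw' using key
  refine ⟨∑ i, w i (v i), fun j => ?_, ?_⟩
  · rw [Finset.sum_apply]
    exact Ideal.sum_mem _ fun i _ => hw i _ (by rw [← pow_succ']; exact hv i) j
  · have : A *ᵥ (∑ i, w i (v i)) = ∑ i, A *ᵥ w i (v i) := map_sum A.mulVecLin _ _
    rw [this]
    refine Eq.trans (Finset.sum_congr rfl fun i _ => ?_) (Finset.univ_sum_single v)
    exact hw' i _ (by rw [← pow_succ']; exact hv i)

theorem isFinitelyDetermined_of_range {A : Matrix (Fin m) (Fin n) R} {N : ℕ}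
    (h : ∀ v : Fin m → R, (∀ i, v i ∈ maximalIdeal R ^ N) → ∃ w, A *ᵥ w = v) :
    IsFinitelyDetermined GrEquiv A := by
  refine ⟨N, fun B hB => ?_⟩
  choose w hw hw' using fun j => exists_mulVec_eq_of_mem_pow_succ h (fun i => B i j) (hB · j)
  let V : Matrix (Fin n) (Fin n) R := Matrix.of fun i j => w j i
  have hAV : A * V = B := by
    ext i j
    exact congrFun (hw' j) i
  have hu : IsUnit (1 + V).det := by
    by_contra hc
    rw [← mem_nonunits_iff, ← mem_maximalIdeal, ← Ideal.Quotient.eq_zero_iff_mem,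
      RingHom.map_det] at hc
    have : (Ideal.Quotient.mk (maximalIdeal R)).mapMatrix (1 + V) = 1 := by
      rw [map_add, map_one]
      ext i j
      simp [V, Ideal.Quotient.eq_zero_iff_mem.mpr (hw j i)]
    rw [this, Matrix.det_one] at hc
    exact one_ne_zero hc
  obtain ⟨u, hu⟩ := (Matrix.isUnit_iff_isUnit_det _).mpr hu
  refine ⟨u, ?_⟩
  rw [hu, Matrix.mul_add, Matrix.mul_one, hAV]

theorem IsFinitelyDetermined.glr {A : Matrix (Fin m) (Fin n) R}
    (h : IsFinitelyDetermined GrEquiv A) : IsFinitelyDetermined GlrEquiv A :=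
  h.imp fun _ hd B hB => .of_grEquiv (hd B hB)

theorem exists_pow_le_of_forall_isPrime [IsNoetherianRing R] {I : Ideal R}
    (h : ∀ P : Ideal R, P.IsPrime → I ≤ P → P = maximalIdeal R) :
    ∃ N, maximalIdeal R ^ N ≤ I := by
  refine Ideal.exists_pow_le_of_le_radical_of_fg ?_ (IsNoetherian.noetherian _)
  rw [Ideal.radical_eq_sInf]
  exact le_sInf fun P hP => (h P hP.2 hP.1).ge

theorem isFinitelyDetermined_of_forall_isPrime [IsNoetherianRing R]
    {A : Matrix (Fin m) (Fin n) R}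
    (h : ∀ P : Ideal R, P.IsPrime → minorIdeal A ≤ P → P = maximalIdeal R) :
    IsFinitelyDetermined GrEquiv A := by
  obtain ⟨N, hN⟩ := exists_pow_le_of_forall_isPrime h
  exact isFinitelyDetermined_of_range (N := N) fun v hv =>
    exists_mulVec_eq_of_mem_minorIdeal A v fun i => hN (hv i)

theorem pow_injective_of_mem_maximalIdeal [IsDomain R] {t : R} (ht : t ∈ maximalIdeal R)
    (h0 : t ≠ 0) : Function.Injective fun s : ℕ => t ^ s := by
  have hnu : ¬ IsUnit t := ht
  have aux : ∀ a b : ℕ, a < b → t ^ a ≠ t ^ b := by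
    intro a b hab he
    obtain ⟨c, rfl⟩ := Nat.exists_eq_add_of_lt hab
    rw [add_assoc, pow_add] at he
    have := mul_left_cancel₀ (pow_ne_zero a h0) ((mul_one _).trans he)
    exact hnu (IsUnit.of_mul_eq_one (t ^ c) (by rw [← pow_succ', ← this]))
  intro a b hab
  rcases lt_trichotomy a b with h | h | h
  · exact absurd hab (aux a b h)
  · exact h
  · exact absurd hab.symm (aux b a h)

/-- The maximal minors of a finitely determined matrix do not vanish at a prime ideal other than
the maximal one. -/

theorem eq_maximalIdeal_of_isFinitelyDetermined (hmn : m ≤ n) {A : Matrix (Fin m) (Fin n) R}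
    (hA : IsFinitelyDetermined GlrEquiv A) (P : Ideal R) [hP : P.IsPrime]
    (hAP : minorIdeal A ≤ P) : P = maximalIdeal R := by
  by_contra hne
  have hle : P ≤ maximalIdeal R := le_maximalIdeal hP.ne_top
  obtain ⟨t, ht, htP⟩ := Set.not_subset.mp fun hc => hne (le_antisymm hle hc)
  obtain ⟨d, hd⟩ := hA
  let f : Fin m → Fin n := Fin.castLE hmn
  let D := R ⧸ P
  have : Nontrivial D := Ideal.Quotient.nontrivial_iff.mpr hP.ne_top
  have : IsLocalRing D := IsLocalRing.of_surjective' (Ideal.Quotient.mk P)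
    Ideal.Quotient.mk_surjective
  let q : R →+* D := Ideal.Quotient.mk P
  let M : Matrix (Fin m) (Fin m) D := -((A.submatrix id f).map q)
  -- The `f`-block of `A + B` is `A_f + t ^ (d + 1 + s)`, whose determinant is the characteristic
  -- polynomial of `-A_f` at that power; it stays in `P` because `A + B` is in the orbit of `A`.
  have hroot : ∀ s : ℕ, M.charpoly.IsRoot (q t ^ (d + 1 + s)) := by
    intro s
    let B : Matrix (Fin m) (Fin n) R :=
      t ^ (d + 1 + s) • Matrix.of fun i j => if j = f i then 1 else 0
    have hB : ∀ i j, B i j ∈ maximalIdeal R ^ (d + 1) := fun i j =>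
      Ideal.mul_mem_right _ _ (Ideal.pow_le_pow_right (Nat.le_add_right _ s)
        (Ideal.pow_mem_pow ht _))
    have h1 := hAP ((hd B hB).minorIdeal_le (det_submatrix_mem_minorIdeal _ f))
    rw [← Ideal.Quotient.eq_zero_iff_mem, RingHom.map_det] at h1
    rw [Polynomial.IsRoot, Matrix.eval_charpoly, ← h1]
    congr 1
    ext i j
    have hij : (f j = f i) ↔ i = j := by
      rw [(Fin.castLE_injective hmn).eq_iff, eq_comm]
    by_cases h : i = j
    · subst h
      simp [M, B, q, add_comm]
    · simp [M, B, q, h, hij]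
  have h0 : q t ≠ 0 := fun h => htP (Ideal.Quotient.eq_zero_iff_mem.mp h)
  have hqt : q t ∈ maximalIdeal D := by
    rw [mem_maximalIdeal, mem_nonunits_iff]
    intro hu
    obtain ⟨y, hy⟩ := hu.exists_right_inv
    obtain ⟨y, rfl⟩ := Ideal.Quotient.mk_surjective y
    have h2 : q (t * y - 1) = 0 := by rw [map_sub, map_mul, map_one]; exact sub_eq_zero.mpr hy
    have h3 := hle (Ideal.Quotient.eq_zero_iff_mem.mp h2)
    have h4 := (maximalIdeal R).sub_mem (Ideal.mul_mem_right y _ ht) h3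
    rw [sub_sub_cancel] at h4
    exact (maximalIdeal.isMaximal R).ne_top ((Ideal.eq_top_iff_one _).mpr h4)
  have hinj := pow_injective_of_mem_maximalIdeal hqt h0
  have hfin : {x | M.charpoly.IsRoot x}.Finite :=
    Polynomial.finite_setOfPred_isRoot M.charpoly_monic.ne_zero
  refine Set.infinite_of_injective_forall_mem (f := fun s => q t ^ (d + 1 + s)) ?_ hroot hfin
  intro a b hab
  simpa using hinj hab

theorem IsFinitelyDetermined.transpose {A : Matrix (Fin m) (Fin n) R}
    (h : IsFinitelyDetermined GlrEquiv A) : IsFinitelyDetermined GlrEquiv Aᵀ :=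
  h.imp fun d hd B hB => by
    have := (hd Bᵀ fun i j => hB j i).transpose
    rwa [Matrix.transpose_add, Matrix.transpose_transpose] at this

theorem minorIdeal_le_maximalIdeal (hm : 1 ≤ m) {A : Matrix (Fin m) (Fin n) R}
    (hA : ∀ i j, A i j ∈ maximalIdeal R) : minorIdeal A ≤ maximalIdeal R := by
  rw [minorIdeal_le_iff]
  intro f
  rw [← Ideal.Quotient.eq_zero_iff_mem, RingHom.map_det]
  exact Matrix.det_eq_zero_of_row_eq_zero ⟨0, hm⟩ fun j =>
    Ideal.Quotient.eq_zero_iff_mem.mpr (hA _ _)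

/-- Entries in `𝔪` ensure that some prime is minimal over the minors; determinacy forces it to be
`𝔪`, whose height is then bounded. -/
theorem ringKrullDim_le_of_isFinitelyDetermined [IsNoetherianRing R] (hm : 1 ≤ m) (hmn : m ≤ n)
    {A : Matrix (Fin m) (Fin n) R} (hA : ∀ i j, A i j ∈ maximalIdeal R)
    (h : IsFinitelyDetermined GlrEquiv A) : ringKrullDim R ≤ (n - m + 1 : ℕ) := by
  obtain ⟨P, hP, -⟩ := Ideal.exists_minimalPrimes_le (minorIdeal_le_maximalIdeal hm hA)
  have hPp := hP.1.1
  have hPm := eq_maximalIdeal_of_isFinitelyDetermined hmn h P hP.1.2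
  have := height_le_of_mem_minimalPrimes_minorIdeal hm hmn A P hP
  rw [hPm] at this
  rw [← maximalIdeal_height_eq_ringKrullDim]
  exact WithBot.coe_le_coe.mpr this

theorem eq_maximalIdeal_of_ringKrullDim_le_height [IsNoetherianRing R] (P : Ideal R) [P.IsPrime]
    (h : ringKrullDim R ≤ P.height) : P = maximalIdeal R := by
  by_contra hne
  have hlt : P < maximalIdeal R := lt_of_le_of_ne (le_maximalIdeal Ideal.IsPrime.ne_top') hne
  have := Ideal.height_strict_mono_of_isPrime_of_isPrime hlt
  rw [← maximalIdeal_height_eq_ringKrullDim, WithBot.coe_le_coe] at h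
  exact absurd this h.not_gt

end determinacy

/-! ### Large dimension, square matrices, coprime minors. -/

section consequences

variable {R : Type*} [CommRing R] [IsLocalRing R] [IsNoetherianRing R] {m n : ℕ}

theorem not_isFinitelyDetermined_of_lt_ringKrullDim (hm : 1 ≤ m) (hn : 1 ≤ n)
    (hdim : ((((n : ℤ) - (m : ℤ)).natAbs + 1 : ℕ) : WithBot ℕ∞) < ringKrullDim R)
    (A : Matrix (Fin m) (Fin n) R) (hA : ∀ i j, A i j ∈ maximalIdeal R) :
    ¬ IsFinitelyDetermined GlrEquiv A := by
  intro h
  rcases le_total m n with hmn | hmn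
  · have e : ((n : ℤ) - (m : ℤ)).natAbs = n - m := by omega
    rw [e] at hdim
    exact (ringKrullDim_le_of_isFinitelyDetermined hm hmn hA h).not_gt hdim
  · have e : ((n : ℤ) - (m : ℤ)).natAbs = m - n := by omega
    rw [e] at hdim
    exact (ringKrullDim_le_of_isFinitelyDetermined hn hmn (fun i j => hA j i)
      h.transpose).not_gt hdim

theorem isFinitelyDetermined_of_det_notMem (hR : ringKrullDim R ≤ 1) (A : Matrix (Fin m) (Fin m) R)
    (h : ∀ P ∈ minimalPrimes R, A.det ∉ P) : IsFinitelyDetermined GrEquiv A := by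
  refine isFinitelyDetermined_of_forall_isPrime fun P hP hAP => ?_
  refine eq_maximalIdeal_of_ringKrullDim_le_height P (hR.trans ?_)
  have hdet : A.det ∈ P := hAP (det_submatrix_mem_minorIdeal A id)
  have : P.height ≠ 0 := fun h0 => h P (Ideal.height_eq_zero_iff.mp h0) hdet
  exact WithBot.coe_le_coe.mpr (Order.one_le_iff_ne_zero.mpr this)

theorem exists_pow_le_span_det {A : Matrix (Fin m) (Fin m) R}
    (h : IsFinitelyDetermined GlrEquiv A) : ∃ N, maximalIdeal R ^ N ≤ Ideal.span {A.det} := by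
  rw [← minorIdeal_square]
  exact exists_pow_le_of_forall_isPrime fun P hP hAP =>
    eq_maximalIdeal_of_isFinitelyDetermined le_rfl h P hAP

theorem isFinitelyDetermined_square_iff (hR : 0 < ringKrullDim R) (hm : 1 ≤ m)
    (A : Matrix (Fin m) (Fin m) R) (hA : ∀ i j, A i j ∈ maximalIdeal R) :
    IsFinitelyDetermined GlrEquiv A ↔ ringKrullDim R = 1 ∧ ∀ P ∈ minimalPrimes R, A.det ∉ P := by
  constructor
  · intro h
    have h1 : ringKrullDim R ≤ 1 := by
      simpa using ringKrullDim_le_of_isFinitelyDetermined hm le_rfl hA h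
    have h2 : 1 ≤ ringKrullDim R := by
      rw [← maximalIdeal_height_eq_ringKrullDim] at hR ⊢
      exact WithBot.coe_le_coe.mpr (Order.one_le_iff_pos.mpr (WithBot.coe_lt_coe.mp hR))
    refine ⟨le_antisymm h1 h2, fun P hP hdet => ?_⟩
    have hPp : P.IsPrime := hP.1.1
    have hPm : P = maximalIdeal R := eq_maximalIdeal_of_isFinitelyDetermined le_rfl h P (by
      rwa [minorIdeal_square, Ideal.span_singleton_le_iff_mem])
    rw [← maximalIdeal_height_eq_ringKrullDim, ← hPm, Ideal.height_eq_zero_iff.mpr hP] at hR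
    exact lt_irrefl _ hR
  · rintro ⟨h1, h2⟩
    exact (isFinitelyDetermined_of_det_notMem h1.le A h2).glr

theorem isFinitelyDetermined_square_iff_mem_nonZeroDivisors (hR : 0 < ringKrullDim R) (hm : 1 ≤ m)
    (A : Matrix (Fin m) (Fin m) R) (hA : ∀ i j, A i j ∈ maximalIdeal R)
    (hx : ringKrullDim R = 1 → ∃ x ∈ maximalIdeal R, x ∈ nonZeroDivisors R) :
    IsFinitelyDetermined GlrEquiv A ↔ ringKrullDim R = 1 ∧ A.det ∈ nonZeroDivisors R := by
  constructor
  · intro h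
    have h1 := ((isFinitelyDetermined_square_iff hR hm A hA).mp h).1
    refine ⟨h1, ?_⟩
    obtain ⟨x, hxm, hx⟩ := hx h1
    -- A power of the nonzerodivisor `x` is a multiple of `A.det`, so `A.det` is a nonzerodivisor
    -- too.
    obtain ⟨N, hN⟩ := exists_pow_le_span_det h
    obtain ⟨y, hy⟩ := Ideal.mem_span_singleton.mp (hN (Ideal.pow_mem_pow hxm N))
    have := pow_mem hx N
    rw [hy] at this
    exact (mul_mem_nonZeroDivisors.mp this).1
  · rintro ⟨h1, h2⟩
    refine (isFinitelyDetermined_square_iff hR hm A hA).mpr ⟨h1, fun P hP hdet => ?_⟩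
    exact Set.disjoint_left.mp (Ideal.disjoint_nonZeroDivisors_of_mem_minimalPrimes hP) hdet h2

theorem isFinitelyDetermined_of_two_minors (hR : ringKrullDim R = 2)
    (A : Matrix (Fin m) (Fin n) R) (e₁ e₂ : Fin m → Fin n)
    (h : ∀ P : Ideal R, P.IsPrime → (A.submatrix id e₁).det ∈ P →
      (A.submatrix id e₂).det ∈ P → 2 ≤ P.height) : IsFinitelyDetermined GrEquiv A := by
  refine isFinitelyDetermined_of_forall_isPrime fun P hP hAP => ?_
  refine eq_maximalIdeal_of_ringKrullDim_le_height P ?_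
  rw [hR]
  exact WithBot.coe_le_coe.mpr (h P hP (hAP (det_submatrix_mem_minorIdeal A e₁))
    (hAP (det_submatrix_mem_minorIdeal A e₂)))

-- In a factorial ring a prime of height at most one is principal, possibly zero, and its generator
-- would be a common nonunit divisor.
omit [IsLocalRing R] [IsNoetherianRing R] in
theorem two_le_height_of_isRelPrime [Nontrivial R] [UniqueFactorizationMonoid R] {a b : R}
    (hab : IsRelPrime a b) (P : Ideal R) [hP : P.IsPrime] (ha : a ∈ P) (hb : b ∈ P) :
    2 ≤ P.height := by
  have : IsDomain R := { }
  by_contra hc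
  have hle : P.height ≤ 1 := Order.le_of_lt_add_one
    (lt_of_not_ge (by rwa [← one_add_one_eq_two] at hc))
  have hnu : ∀ p ∈ P, p ∣ a → p ∣ b → False := fun p hp h1 h2 =>
    hP.ne_top (Ideal.eq_top_of_isUnit_mem _ hp (hab h1 h2))
  rcases hle.lt_or_eq with h0 | h1
  · rw [Order.lt_one_iff, Ideal.height_eq_zero_iff_eq_bot] at h0
    subst h0
    exact hnu 0 (Ideal.zero_mem _) (by simpa using ha) (by simpa using hb)
  · obtain ⟨x, hx⟩ := UniqueFactorizationMonoid.isPrincipal_of_height_eq_one h1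
    have hx' : P = Ideal.span {x} := hx
    rw [hx'] at ha hb
    exact hnu x (hx' ▸ Ideal.mem_span_singleton_self x) (Ideal.mem_span_singleton.mp ha)
      (Ideal.mem_span_singleton.mp hb)

end consequences

/-! ### Heights under elimination of variables. -/

section height

-- An extended proper ideal contains no monic polynomial, so the extension of the contraction of `P`
-- is strictly smaller than `P`.
open Polynomial in
theorem height_comap_C_add_one_le {A : Type*} [CommRing A] [IsNoetherianRing A] (P : Ideal A[X])
    [P.IsPrime] {p : A[X]} (hp : p.Monic) (hpP : p ∈ P) :
    (P.comap (C : A →+* A[X])).height + 1 ≤ P.height := by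
  have hQ : (P.comap (C : A →+* A[X])).IsPrime := Ideal.comap_isPrime _ _
  have hQ' : ((P.comap (C : A →+* A[X])).map C).IsPrime := Ideal.isPrime_map_C_of_isPrime
  have hlt : (P.comap (C : A →+* A[X])).map C < P := by
    refine lt_of_le_not_ge Ideal.map_comap_le fun hc => ?_
    have := Ideal.mem_map_C_iff.mp (hc hpP) p.natDegree
    rw [hp.coeff_natDegree] at this
    exact hQ.ne_top ((Ideal.eq_top_iff_one _).mpr this)
  exact (add_le_add_left (height_le_height_map_C _) 1).trans
    (Ideal.height_add_one_le_of_lt_of_isPrime hlt)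

theorem height_comap_mvPolynomial_C_le {A τ : Type*} [CommRing A] [IsNoetherianRing A] [Finite τ]
    (P : Ideal (MvPolynomial τ A)) [P.IsPrime] :
    (P.comap (MvPolynomial.C : A →+* MvPolynomial τ A)).height ≤ P.height := by
  have : (P.comap (MvPolynomial.C : A →+* MvPolynomial τ A)).IsPrime := Ideal.comap_isPrime _ _
  have : P.LiesOver (P.comap (MvPolynomial.C : A →+* MvPolynomial τ A)) := ⟨rfl⟩
  rw [Ideal.height_eq_height_add_of_liesOver_of_hasGoingDown
    (P.comap (MvPolynomial.C : A →+* MvPolynomial τ A)) P]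
  exact le_self_add

theorem height_comap_rename_inr_le {K σ τ : Type*} [Field K] [Finite σ] [Finite τ]
    (P : Ideal (MvPolynomial (τ ⊕ σ) K)) [P.IsPrime] :
    (P.comap (MvPolynomial.rename (R := K) (Sum.inr : σ → τ ⊕ σ))).height ≤ P.height := by
  let e := MvPolynomial.sumAlgEquiv K τ σ
  let P' : Ideal (MvPolynomial τ (MvPolynomial σ K)) := P.comap e.symm.toRingEquiv
  have hP' : P'.IsPrime := Ideal.comap_isPrime _ _
  have h1 : P'.height = P.height := RingEquiv.height_comap _ _
  have h2 : P.comap (MvPolynomial.rename (R := K) (Sum.inr : σ → τ ⊕ σ)) =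
      P'.comap (MvPolynomial.C : MvPolynomial σ K →+* MvPolynomial τ (MvPolynomial σ K)) := by
    have h3 : (e.symm.toRingEquiv.toRingHom.comp MvPolynomial.C) =
        (MvPolynomial.rename (R := K) (Sum.inr : σ → τ ⊕ σ)).toRingHom := by
      apply MvPolynomial.ringHom_ext
      · intro r
        simp [e]
      · intro i
        simp [e]
    ext x
    have h4 := RingHom.congr_fun h3 x
    simp only [Ideal.mem_comap, P']
    exact (congrArg (· ∈ P) h4).symm.to_iff
  rw [h2, ← h1]
  exact height_comap_mvPolynomial_C_le P'

/-- Eliminating `none`, the variable in which `p` is monic, lowers the height by at least one;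
eliminating `τ` afterwards cannot raise it. -/
theorem height_comap_rename_add_one_le {K σ τ : Type*} [Field K] [Finite σ] [Finite τ]
    (P : Ideal (MvPolynomial (Option (τ ⊕ σ)) K)) [P.IsPrime]
    {p : MvPolynomial (Option (τ ⊕ σ)) K}
    (hp : (MvPolynomial.optionEquivLeft K (τ ⊕ σ) p).Monic) (hpP : p ∈ P) :
    (P.comap (MvPolynomial.rename (R := K) fun i : σ => some (Sum.inr i : τ ⊕ σ))).height + 1 ≤
      P.height := by
  let e := MvPolynomial.optionEquivLeft K (τ ⊕ σ)
  let P' : Ideal (Polynomial (MvPolynomial (τ ⊕ σ) K)) := P.comap e.symm.toRingEquiv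
  have hP' : P'.IsPrime := Ideal.comap_isPrime _ _
  have h1 : P'.height = P.height := RingEquiv.height_comap _ _
  have hpP' : e p ∈ P' := by
    rw [Ideal.mem_comap]
    exact (congrArg (· ∈ P) (e.symm_apply_apply p)).mpr hpP
  have h2 := height_comap_C_add_one_le P' hp hpP'
  have hQ : (P'.comap (Polynomial.C : MvPolynomial (τ ⊕ σ) K →+* _)).IsPrime :=
    Ideal.comap_isPrime _ _
  have h3 := height_comap_rename_inr_le (P'.comap (Polynomial.C : MvPolynomial (τ ⊕ σ) K →+* _))
  have h4 : P.comap (MvPolynomial.rename (R := K) fun i : σ => some (Sum.inr i : τ ⊕ σ)) =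
      (P'.comap (Polynomial.C : MvPolynomial (τ ⊕ σ) K →+* _)).comap
        (MvPolynomial.rename (R := K) (Sum.inr : σ → τ ⊕ σ)) := by
    have h5 : (e.symm.toRingEquiv.toRingHom.comp Polynomial.C).comp (MvPolynomial.rename (R := K) (Sum.inr : σ → τ ⊕ σ)).toRingHom =
        (MvPolynomial.rename (R := K) fun i : σ => some (Sum.inr i : τ ⊕ σ)).toRingHom := by
      apply MvPolynomial.ringHom_ext
      · intro r
        simp [e]
      · intro i
        simp [e]
    ext x
    have h6 := RingHom.congr_fun h5 x
    simp only [Ideal.mem_comap, P']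
    exact (congrArg (· ∈ P) h6).symm.to_iff
  rw [h4, ← h1]
  exact (add_le_add_left h3 1).trans h2

end height

/-! ### Codimension in adapted linear coordinates. -/

section codimension

open Module MvPolynomial

variable {K V W ι ι' : Type*} [Field K] [AddCommGroup V] [Module K V] [AddCommGroup W] [Module K W]

/-- The ideal of the polynomials, in the linear coordinates given by a basis, that vanish on a set
of vectors. -/
noncomputable def coordIdeal (b : Basis ι K V) (S : Set V) : Ideal (MvPolynomial ι K) :=
  vanishingIdeal K ((fun v i => b.repr v i) '' S)

theorem mem_coordIdeal {b : Basis ι K V} {S : Set V} {p : MvPolynomial ι K} :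
    p ∈ coordIdeal b S ↔ ∀ v ∈ S, aeval (fun i => b.repr v i) p = 0 := by
  rw [coordIdeal, mem_vanishingIdeal_iff, Set.forall_mem_image]

/-- The substitution that changes linear coordinates. -/
noncomputable def coordChange [Fintype ι'] (b : Basis ι K V) (b' : Basis ι' K V) :
    MvPolynomial ι K →ₐ[K] MvPolynomial ι' K :=
  aeval fun i => ∑ j, C (b.repr (b' j) i) * X j

theorem sum_repr_mul_repr [Fintype ι'] (b : Basis ι K V) (b' : Basis ι' K V) (v : V) (i : ι) :
    ∑ j, b.repr (b' j) i * b'.repr v j = b.repr v i := by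
  have := congrArg (fun w => b.repr w i) (b'.sum_repr v)
  simp only [map_sum, map_smul, Finsupp.finsetSum_apply, Finsupp.smul_apply, smul_eq_mul] at this
  simpa only [mul_comm] using this

theorem aeval_coordChange [Fintype ι'] (b : Basis ι K V) (b' : Basis ι' K V) (v : V)
    (p : MvPolynomial ι K) :
    aeval (fun i => b'.repr v i) (coordChange b b' p) = aeval (fun i => b.repr v i) p := by
  rw [← AlgHom.comp_apply]
  congr 1
  ext i
  rw [AlgHom.comp_apply, coordChange, aeval_X, aeval_X, map_sum]
  simpa using sum_repr_mul_repr b b' v i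

theorem coordChange_comp [Fintype ι] [Fintype ι'] (b : Basis ι K V) (b' : Basis ι' K V) :
    (coordChange b' b).comp (coordChange b b') = AlgHom.id K _ := by
  classical
  ext1 i
  simp only [AlgHom.comp_apply, coordChange, aeval_X, map_sum, map_mul, algHom_C, algebraMap_eq,
    AlgHom.id_apply, Finset.mul_sum]
  rw [Finset.sum_comm]
  simp only [← mul_assoc, ← map_mul, ← Finset.sum_mul, ← map_sum, sum_repr_mul_repr]
  simp [Finsupp.single_apply]

theorem height_coordIdeal_eq [Fintype ι] [Fintype ι'] (b : Basis ι K V) (b' : Basis ι' K V)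
    (S : Set V) : (coordIdeal b S).height = (coordIdeal b' S).height := by
  let e : MvPolynomial ι K ≃ₐ[K] MvPolynomial ι' K :=
    AlgEquiv.ofAlgHom (coordChange b b') (coordChange b' b) (coordChange_comp b' b)
      (coordChange_comp b b')
  have h : coordIdeal b S = (coordIdeal b' S).comap e.toRingEquiv := by
    ext p
    rw [Ideal.mem_comap, mem_coordIdeal, mem_coordIdeal]
    exact forall₂_congr fun v _ => by rw [← aeval_coordChange b b' v p]; rfl
  rw [h]
  exact RingEquiv.height_comap _ _

theorem zariskiCodim_eq_height_coordIdeal [FiniteDimensional K V] [Fintype ι] (b : Basis ι K V)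
    (S : Set V) : zariskiCodim K S = (coordIdeal b S).height := by
  classical
  have : Fintype (Basis.ofVectorSpaceIndex K V) := FiniteDimensional.fintypeBasisIndex
    (Basis.ofVectorSpace K V)
  exact height_coordIdeal_eq _ b S

/-- It suffices to bound each minimal prime `P` over the ideal of `S`: its contraction contains the
equations of `T`, and `p ∈ P` supplies the additional unit of height. -/
theorem height_coordIdeal_add_one_le {σ τ : Type*} [Fintype σ] [Fintype τ]
    (b : Basis (Option (τ ⊕ σ)) K V) (b' : Basis σ K W) (π : V →ₗ[K] W)
    (hσ : ∀ v i, b.repr v (some (Sum.inr i)) = b'.repr (π v) i) {S : Set V} {T : Set W}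
    (hST : ∀ v ∈ S, π v ∈ T) {p : MvPolynomial (Option (τ ⊕ σ)) K}
    (hp : (optionEquivLeft K (τ ⊕ σ) p).Monic) (hpS : p ∈ coordIdeal b S) :
    (coordIdeal b' T).height + 1 ≤ (coordIdeal b S).height := by
  rw [Ideal.height_eq_inf_minimalPrimes (coordIdeal b S)]
  refine le_iInf₂ fun P hP => ?_
  have hPp : P.IsPrime := hP.1.1
  refine le_trans ?_ (height_comap_rename_add_one_le P hp (hP.1.2 hpS))
  gcongr
  intro q hq
  rw [Ideal.mem_comap]
  refine hP.1.2 ?_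
  rw [mem_coordIdeal] at hq ⊢
  intro v hv
  rw [aeval_rename]
  convert hq _ (hST v hv) using 3
  funext i
  exact hσ v i

/-- A section of `π` splits `V` as `ker π × W`; `x` is completed to a basis of the kernel, with `τ`
indexing the other kernel vectors. -/
theorem exists_adapted_basis.{v} {V : Type v} [AddCommGroup V] [Module K V]
    [FiniteDimensional K V] (π : V →ₗ[K] W) (hπ : Function.Surjective π)
    {x : V} (hx : π x = 0) (hx0 : x ≠ 0) {σ : Type*} (b' : Basis σ K W) :
    ∃ (τ : Type v) (_ : Fintype τ) (b : Basis (Option (τ ⊕ σ)) K V), b none = x ∧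
      ∀ v i, b.repr v (some (Sum.inr i)) = b'.repr (π v) i := by
  classical
  obtain ⟨s, hs⟩ := π.exists_rightInverse_of_surjective (LinearMap.range_eq_top.mpr hπ)
  have hs' : ∀ w, π (s w) = w := fun w => LinearMap.congr_fun hs w
  let e : V ≃ₗ[K] LinearMap.ker π × W := LinearEquiv.ofLinearMap
    (((LinearMap.id - s ∘ₗ π).codRestrict (LinearMap.ker π) fun v => by simp [hs']).prod π)
    ((LinearMap.ker π).subtype.coprod s)
    (by
      apply LinearMap.ext
      rintro ⟨⟨k, hk⟩, w⟩
      rw [LinearMap.mem_ker] at hk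
      ext <;> simp [hs', hk])
    (by ext v; simp)
  let x' : LinearMap.ker π := ⟨x, hx⟩
  have hx' : x' ≠ 0 := fun h => hx0 (congrArg Subtype.val h)
  have hli : LinearIndepOn K id ({x'} : Set (LinearMap.ker π)) :=
    LinearIndepOn.singleton hx'
  let bk := Basis.extend hli
  let k0 : hli.extend (Set.subset_univ _) := ⟨x', hli.subset_extend _ rfl⟩
  have hk0 : bk k0 = x' := Basis.extend_apply_self hli k0
  have : Fintype (hli.extend (Set.subset_univ _)) := FiniteDimensional.fintypeBasisIndex bk
  let τ := {i : hli.extend (Set.subset_univ _) // i ≠ k0}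
  let eq1 : hli.extend (Set.subset_univ _) ⊕ σ ≃ Option (τ ⊕ σ) :=
    ((Equiv.optionSubtypeNe k0).symm.sumCongr (Equiv.refl σ)).trans
      { toFun := Sum.elim (fun o => o.map Sum.inl) (fun i => some (Sum.inr i))
        invFun := fun o => o.elim (Sum.inl none) (Sum.elim (fun t => Sum.inl (some t)) Sum.inr)
        left_inv := by rintro ((_ | _) | _) <;> rfl
        right_inv := by rintro (_ | _ | _) <;> rfl }
  refine ⟨τ, inferInstance, ((bk.prod b').map e.symm).reindex eq1, ?_, fun v i => ?_⟩
  · simp [eq1, Basis.reindex_apply, hk0, e, x']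
  · have h1 : eq1.symm (some (Sum.inr i)) = Sum.inr i := rfl
    rw [Basis.repr_reindex_apply, h1, Basis.map_repr, LinearEquiv.trans_apply, Basis.prod_repr_inr]
    rfl

/-- If `π v ∈ T` for `v ∈ S`, and a determinantal polynomial that is monic in a direction of the
kernel of `π` vanishes on `S`, the codimension of `S` exceeds that of `T`. -/
theorem zariskiCodim_add_one_le [FiniteDimensional K V] [FiniteDimensional K W] (π : V →ₗ[K] W)
    (hπ : Function.Surjective π) {x : V} (hx : π x = 0) {S : Set V} {T : Set W}
    (hST : ∀ v ∈ S, π v ∈ T) {r : ℕ} (M : Matrix (Fin r) (Fin r) K)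
    (Λ : V →ₗ[K] Matrix (Fin r) (Fin r) K) (hΛ : Λ x = 1) (hS : ∀ v ∈ S, (M + Λ v).det = 0) :
    zariskiCodim K T + 1 ≤ zariskiCodim K S := by
  classical
  rcases Nat.eq_zero_or_pos r with rfl | hr
  · have hS0 : S = ∅ := Set.eq_empty_of_forall_notMem fun v hv => by
      simpa using hS v hv
    have htop : zariskiCodim K (∅ : Set V) = ⊤ := by
      rw [zariskiCodim, Set.image_empty, vanishingIdeal_empty, Ideal.height_top]
    rw [hS0, htop]
    exact le_top
  have hx0 : x ≠ 0 := by
    rintro rfl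
    have : NeZero r := ⟨hr.ne'⟩
    have := congrFun₂ hΛ 0 0
    simp at this
  let b' := Module.finBasis K W
  obtain ⟨τ, _, b, hb, hb'⟩ := exists_adapted_basis π hπ hx hx0 b'
  rw [zariskiCodim_eq_height_coordIdeal b', zariskiCodim_eq_height_coordIdeal b]
  -- `N` is `M + Λ v` in generic coordinates. Since `Λ x = 1` and `x` is the basis vector `none`,
  -- its determinant has the form `det (X 1 + N')`, monic in that variable.
  let N : Matrix (Fin r) (Fin r) (MvPolynomial (Option (τ ⊕ Fin (finrank K W))) K) :=
    M.map C + ∑ i, (X i : MvPolynomial _ K) • (Λ (b i)).map C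
  refine height_coordIdeal_add_one_le b b' π hb' hST (p := N.det) ?_ ?_
  · let N' : Matrix (Fin r) (Fin r) (MvPolynomial (τ ⊕ Fin (finrank K W)) K) :=
      M.map C + ∑ i, (X i : MvPolynomial _ K) • (Λ (b (some i))).map C
    have := Polynomial.leadingCoeff_det_X_one_add_C N'
    rw [Polynomial.Monic, ← this]
    congr 1
    rw [AlgEquiv.map_det]
    congr 1
    ext1 i j
    have h1 : (C ((1 : Matrix (Fin r) (Fin r) K) i j) :
        MvPolynomial (Option (τ ⊕ Fin (finrank K W))) K) = (1 : Matrix (Fin r) (Fin r) _) i j := by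
      rw [Matrix.one_apply, Matrix.one_apply]
      split_ifs <;> simp
    have h2 : optionEquivLeft K (τ ⊕ Fin (finrank K W)) ((1 : Matrix (Fin r) (Fin r) _) i j) =
        (1 : Matrix (Fin r) (Fin r) _) i j := by
      rw [Matrix.one_apply, Matrix.one_apply]
      split_ifs <;> simp
    simp only [N, N', Fintype.sum_option, hb, hΛ, Matrix.sum_apply, Matrix.add_apply,
      Matrix.map_apply, Matrix.smul_apply, smul_eq_mul, map_add, map_mul, map_sum, h1, h2,
      AlgEquiv.mapMatrix_apply, optionEquivLeft_C, optionEquivLeft_X_none,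
      optionEquivLeft_X_some]
    exact add_left_comm _ _ _
  · rw [mem_coordIdeal]
    intro v hv
    rw [AlgHom.map_det, ← hS v hv]
    congr 1
    have hv' : Λ v = ∑ i, b.repr v i • Λ (b i) := by
      simp only [← map_smul, ← map_sum, b.sum_repr]
    rw [hv']
    ext1 i j
    simp [N, Matrix.sum_apply]

theorem exists_comp_comp_eq_one {U W : Type*} [AddCommGroup U] [Module K U] [AddCommGroup W]
    [Module K W] [FiniteDimensional K W] (f : U →ₗ[K] W) {r : ℕ}
    (hr : finrank K (LinearMap.range f) = r) :
    ∃ (i : (Fin r → K) →ₗ[K] U) (q : W →ₗ[K] (Fin r → K)), q ∘ₗ f ∘ₗ i = LinearMap.id := by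
  subst hr
  let e : LinearMap.range f ≃ₗ[K] (Fin (finrank K (LinearMap.range f)) → K) :=
    (Module.finBasis K (LinearMap.range f)).equivFun
  obtain ⟨s, hs⟩ := f.rangeRestrict.exists_rightInverse_of_surjective f.range_rangeRestrict
  obtain ⟨p, hp⟩ := (LinearMap.range f).subtype.exists_leftInverse_of_injective
    (LinearMap.range f).ker_subtype
  refine ⟨s ∘ₗ e.symm, e ∘ₗ p, ?_⟩
  ext1 v
  have h1 : ∀ y : LinearMap.range f, f (s y) = y := fun y =>
    congrArg Subtype.val (LinearMap.congr_fun hs y)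
  have h2 : ∀ y : LinearMap.range f, p y = y := fun y => LinearMap.congr_fun hp y
  ext k
  simp [h1, h2]

/-- Composing with `i` and `q` turns `Λ x` into an identity matrix whose size is its rank; the same
compression of `f + Λ v` is singular wherever the rank is smaller. -/
theorem zariskiCodim_add_one_le_of_rank {U Y : Type*} [AddCommGroup U] [Module K U]
    [AddCommGroup Y] [Module K Y] [FiniteDimensional K Y]
    [FiniteDimensional K V] [FiniteDimensional K W] (π : V →ₗ[K] W)
    (hπ : Function.Surjective π) {x : V} (hx : π x = 0) {S : Set V} {T : Set W}
    (hST : ∀ v ∈ S, π v ∈ T) (f : U →ₗ[K] Y) (Λ : V →ₗ[K] (U →ₗ[K] Y))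
    (hS : ∀ v ∈ S, finrank K (LinearMap.range (f + Λ v)) < finrank K (LinearMap.range (Λ x))) :
    zariskiCodim K T + 1 ≤ zariskiCodim K S := by
  obtain ⟨r, hr⟩ : ∃ r, finrank K (LinearMap.range (Λ x)) = r := ⟨_, rfl⟩
  rw [hr] at hS
  obtain ⟨i, q, hiq⟩ := exists_comp_comp_eq_one (Λ x) hr
  let Φ : (U →ₗ[K] Y) →ₗ[K] Matrix (Fin r) (Fin r) K :=
    (LinearMap.toMatrix' (R := K) (m := Fin r) (n := Fin r)).toLinearMap ∘ₗ
      (LinearMap.llcomp K (Fin r → K) Y (Fin r → K) q) ∘ₗ (LinearMap.lcomp K Y i)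
  have hΦ : ∀ g, Φ g = LinearMap.toMatrix' (q ∘ₗ g ∘ₗ i) := fun g => rfl
  refine zariskiCodim_add_one_le π hπ hx hST (Φ f) (Φ ∘ₗ Λ) ?_ fun v hv => ?_
  · rw [LinearMap.comp_apply, hΦ, hiq, LinearMap.toMatrix'_id]
  · rw [LinearMap.comp_apply Φ Λ, ← map_add Φ, hΦ, LinearMap.det_toMatrix']
    by_contra hne
    have hsurj : LinearMap.range (q ∘ₗ (f + Λ v) ∘ₗ i) = ⊤ :=
      LinearMap.range_eq_top.mpr ((LinearMap.equivOfDetNeZero _ hne).surjective)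
    have h1 : finrank K (LinearMap.range (q ∘ₗ (f + Λ v) ∘ₗ i)) = r := by
      rw [hsurj, finrank_top, Module.finrank_fin_fun]
    have h2 : LinearMap.range (q ∘ₗ (f + Λ v) ∘ₗ i) ≤ (LinearMap.range (f + Λ v)).map q := by
      rw [LinearMap.range_comp]
      exact Submodule.map_mono (LinearMap.range_comp_le_range _ _)
    have h3 := (Submodule.finrank_mono h2).trans (Submodule.finrank_map_le q _)
    have := hS v hv
    omega

end codimension

/-! ### Coranks on jets and infinite codimension. -/

section jets

open Module

variable (K : Type*) {R : Type*} [Field K] [CommRing R] [IsLocalRing R] [Algebra K R] {m n : ℕ}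

theorem finite_quotient_maximalIdeal_pow [IsNoetherianRing R] [Module.Finite K (ResidueField R)]
    (k : ℕ) : Module.Finite K (R ⧸ maximalIdeal R ^ k) := by
  rcases Nat.eq_zero_or_pos k with rfl | hk
  · rw [pow_zero, Ideal.one_eq_top]
    infer_instance
  have hle : maximalIdeal R ^ k ≤ maximalIdeal R := Ideal.pow_le_self hk.ne'
  have : Module.Finite K (R ⧸ maximalIdeal R) :=
    inferInstanceAs (Module.Finite K (ResidueField R))
  refine Module.finite_of_surjective_of_ker_le_nilradical (R := K)
    (Ideal.Quotient.factorₐ K hle) (Ideal.Quotient.factor_surjective hle) ?_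
    (IsNoetherian.noetherian _)
  intro x hx
  obtain ⟨x, rfl⟩ := Ideal.Quotient.mk_surjective x
  have hx' : x ∈ maximalIdeal R := Ideal.Quotient.eq_zero_iff_mem.mp hx
  refine ⟨k, ?_⟩
  rw [← map_pow]
  exact Ideal.Quotient.eq_zero_iff_mem.mpr (Ideal.pow_mem_pow hx' k)

/-- Multiplication of column vectors by the reduction of a matrix modulo `𝔪 ^ k`. -/
noncomputable def jetMulVec (k : ℕ) (C : Matrix (Fin m) (Fin n) R) :
    (Fin n → R ⧸ maximalIdeal R ^ k) →ₗ[K] (Fin m → R ⧸ maximalIdeal R ^ k) :=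
  (matrixJet K m n k C).mulVecLin.restrictScalars K

theorem jetMulVec_apply_mk (k : ℕ) (C : Matrix (Fin m) (Fin n) R) (w : Fin n → R) :
    jetMulVec K k C (fun j => Ideal.Quotient.mk _ (w j)) =
      fun i => Ideal.Quotient.mk _ ((C *ᵥ w) i) := by
  funext i
  simp [jetMulVec, matrixJet, Matrix.mulVec, dotProduct]

omit [IsLocalRing R] in
theorem exists_mk_eq {I : Ideal R} (w : Fin n → R ⧸ I) :
    ∃ v : Fin n → R, w = fun j => Ideal.Quotient.mk I (v j) := by
  choose v hv using fun j => Ideal.Quotient.mk_surjective (w j)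
  exact ⟨v, funext fun j => (hv j).symm⟩

/-- The image contains the kernel of reduction modulo `𝔪 ^ N`, so the corank on `k`-jets is bounded
independently of `k`. -/
theorem finrank_le_finrank_range_jetMulVec_add [IsNoetherianRing R]
    [Module.Finite K (ResidueField R)] {X : Matrix (Fin m) (Fin n) R} {N : ℕ}
    (hX : ∀ v : Fin m → R, (∀ i, v i ∈ maximalIdeal R ^ N) → ∃ w, X *ᵥ w = v) {k : ℕ}
    (hk : N ≤ k) :
    finrank K (Fin m → R ⧸ maximalIdeal R ^ k) ≤
      finrank K (LinearMap.range (jetMulVec K k X)) +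
        finrank K (Fin m → R ⧸ maximalIdeal R ^ N) := by
  have := finite_quotient_maximalIdeal_pow K (R := R)
  have hle : maximalIdeal R ^ k ≤ maximalIdeal R ^ N := Ideal.pow_le_pow_right hk
  let ψ : (Fin m → R ⧸ maximalIdeal R ^ k) →ₗ[K] (Fin m → R ⧸ maximalIdeal R ^ N) :=
    (Ideal.Quotient.factorₐ K hle).toLinearMap.compLeft (Fin m)
  have hker : LinearMap.ker ψ ≤ LinearMap.range (jetMulVec K k X) := by
    intro v hv
    obtain ⟨v, rfl⟩ := exists_mk_eq v
    obtain ⟨w, hw⟩ := hX v fun i => Ideal.Quotient.eq_zero_iff_mem.mp (congrFun hv i)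
    exact ⟨fun j => Ideal.Quotient.mk _ (w j), by rw [jetMulVec_apply_mk, hw]⟩
  rw [← LinearMap.finrank_range_add_finrank_ker ψ, add_comm]
  exact add_le_add (Submodule.finrank_mono hker) (Submodule.finrank_le _)

omit [IsLocalRing R] in
theorem mem_ideal_smul_top {I : Ideal R} {v : Fin m → R} (hv : ∀ i, v i ∈ I) :
    v ∈ I • (⊤ : Submodule R (Fin m → R)) := by
  rw [← Finset.univ_sum_single v]
  refine Submodule.sum_mem _ fun i _ => ?_
  have : Pi.single i (v i) = v i • (Pi.single i 1 : Fin m → R) := by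
    rw [← Pi.single_smul, smul_eq_mul, mul_one]
  rw [this]
  exact Submodule.smul_mem_smul (hv i) Submodule.mem_top

theorem isFinitelyDetermined_of_pow_smul_le [IsNoetherianRing R] {C : Matrix (Fin m) (Fin n) R}
    {j : ℕ} (h : maximalIdeal R ^ j • (⊤ : Submodule R (Fin m → R)) ≤
      LinearMap.range C.mulVecLin ⊔ maximalIdeal R ^ (j + 1) • ⊤) :
    IsFinitelyDetermined GrEquiv C := by
  rw [pow_succ', Submodule.mul_smul] at h
  have h1 := Submodule.le_of_le_smul_of_le_jacobson_bot (IsNoetherian.noetherian _)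
    (maximalIdeal_le_jacobson ⊥) h
  exact isFinitelyDetermined_of_range (N := j) fun v hv => h1 (mem_ideal_smul_top hv)

/-- The images of `im C + 𝔪 ^ j R^m` in the `k`-jets drop strictly at each of `k` steps: a
repetition would give `𝔪 ^ j R^m ≤ im C` by Nakayama, hence determinacy. -/
theorem finrank_range_jetMulVec_add_le [IsNoetherianRing R]
    [Module.Finite K (ResidueField R)] {C : Matrix (Fin m) (Fin n) R}
    (hC : ¬ IsFinitelyDetermined GrEquiv C) (k : ℕ) :
    finrank K (LinearMap.range (jetMulVec K k C)) + k ≤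
      finrank K (Fin m → R ⧸ maximalIdeal R ^ k) := by
  have := finite_quotient_maximalIdeal_pow K (R := R)
  let red : (Fin m → R) →ₗ[R] (Fin m → R ⧸ maximalIdeal R ^ k) :=
    (Submodule.mkQ (maximalIdeal R ^ k)).compLeft (Fin m)
  let H : ℕ → Submodule R (Fin m → R) := fun j =>
    LinearMap.range C.mulVecLin ⊔ maximalIdeal R ^ j • ⊤
  let G : ℕ → Submodule K (Fin m → R ⧸ maximalIdeal R ^ k) := fun j =>
    ((H j).map red).restrictScalars K
  have hmono : ∀ i j, i ≤ j → H j ≤ H i := fun i j hij =>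
    sup_le_sup_left (Submodule.smul_mono_left (Ideal.pow_le_pow_right hij)) _
  have hker : ∀ j ≤ k, LinearMap.ker red ≤ H j := by
    intro j hj v hv
    have hv' : ∀ i, v i ∈ maximalIdeal R ^ k := fun i =>
      Ideal.Quotient.eq_zero_iff_mem.mp (congrFun hv i)
    exact hmono j k hj (Submodule.mem_sup_right (mem_ideal_smul_top hv'))
  have hlt : ∀ j < k, G (j + 1) < G j := by
    intro j hj
    refine lt_of_le_not_ge (Submodule.map_mono (hmono _ _ j.le_succ)) fun hc => hC ?_
    have hc' : (H j).map red ≤ (H (j + 1)).map red := hc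
    have h1 := Submodule.comap_mono (f := red) hc'
    rw [Submodule.comap_map_eq, Submodule.comap_map_eq, sup_eq_left.mpr (hker j hj.le),
      sup_eq_left.mpr (hker (j + 1) hj)] at h1
    exact isFinitelyDetermined_of_pow_smul_le (j := j) (le_sup_right.trans h1)
  have hdim : ∀ j ≤ k, finrank K (G j) + j ≤ finrank K (Fin m → R ⧸ maximalIdeal R ^ k) := by
    intro j hj
    induction j with
    | zero => exact Submodule.finrank_le _
    | succ j ih =>
      have h1 := Submodule.finrank_lt_finrank_of_lt (hlt j hj)
      have h2 := ih (Nat.le_of_succ_le hj)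
      omega
  have hrange : LinearMap.range (jetMulVec K k C) ≤ G k := by
    rintro _ ⟨w, rfl⟩
    obtain ⟨w, rfl⟩ := exists_mk_eq w
    rw [jetMulVec_apply_mk]
    exact ⟨C *ᵥ w, Submodule.mem_sup_left ⟨w, rfl⟩, rfl⟩
  exact (add_le_add_left (Submodule.finrank_mono hrange) k).trans (hdim k le_rfl)

/-- The map between the spaces of jets of different orders. -/
noncomputable def jetProjection (E : Submodule K (Matrix (Fin m) (Fin n) R)) {k₀ k : ℕ}
    (h : k₀ ≤ k) : E.map (matrixJet K m n k) →ₗ[K] E.map (matrixJet K m n k₀) :=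
  LinearMap.restrict
    (Ideal.Quotient.factorₐ K (Ideal.pow_le_pow_right (I := maximalIdeal R) h)).toLinearMap.mapMatrix
    (by
      rintro _ ⟨B, hB, rfl⟩
      exact ⟨B, hB, rfl⟩)

theorem jetProjection_mk (E : Submodule K (Matrix (Fin m) (Fin n) R)) {k₀ k : ℕ} (h : k₀ ≤ k)
    {B : Matrix (Fin m) (Fin n) R} (hB : B ∈ E) :
    jetProjection K E h ⟨matrixJet K m n k B, Submodule.mem_map_of_mem hB⟩ =
      ⟨matrixJet K m n k₀ B, Submodule.mem_map_of_mem hB⟩ := rfl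

/-- If `E` contains matrices of finite colength and arbitrarily high order, the matrices of `A + E`
that are not finitely determined are of infinite codimension. -/
theorem hasInfiniteCodim_of_exists [IsNoetherianRing R] [Module.Finite K (ResidueField R)]
    (E : Submodule K (Matrix (Fin m) (Fin n) R)) (A : Matrix (Fin m) (Fin n) R)
    (hE : ∀ s, ∃ X ∈ E, (∀ i j, X i j ∈ maximalIdeal R ^ s) ∧
      ∃ N, ∀ v : Fin m → R, (∀ i, v i ∈ maximalIdeal R ^ N) → ∃ w, X *ᵥ w = v) :
    HasInfiniteCodim K E {B | ¬ IsFinitelyDetermined GrEquiv (A + B)} := by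
  have := finite_quotient_maximalIdeal_pow K (R := R)
  intro c
  induction c with
  | zero => exact ⟨0, fun k _ => by simp⟩
  | succ c ih =>
    obtain ⟨k₀, hk₀⟩ := ih
    obtain ⟨X, hXE, hX, N, hN⟩ := hE k₀
    let L := finrank K (Fin m → R ⧸ maximalIdeal R ^ N)
    -- `N ≤ k` bounds the corank of `X` by `L`, and `L < k` makes it smaller than the corank of
    -- every bad `A + B`. The order `k₀` of `X` puts its jet in the kernel of the projection to
    -- `k₀`-jets.
    refine ⟨max k₀ (max N (L + 1)), fun k hk => ?_⟩
    have hkk₀ : k₀ ≤ k := (le_max_left _ _).trans hk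
    have hkN : N ≤ k := (le_max_left _ _).trans ((le_max_right _ _).trans hk)
    have hkL : L + 1 ≤ k := (le_max_right _ _).trans ((le_max_right _ _).trans hk)
    let Λ : E.map (matrixJet K m n k) →ₗ[K]
        ((Fin n → R ⧸ maximalIdeal R ^ k) →ₗ[K] (Fin m → R ⧸ maximalIdeal R ^ k)) :=
      { toFun := fun x => x.1.mulVecLin.restrictScalars K
        map_add' := fun x y => LinearMap.ext fun v => by simp
        map_smul' := fun a x => LinearMap.ext fun v => by simp }
    let x : E.map (matrixJet K m n k) := ⟨matrixJet K m n k X, Submodule.mem_map_of_mem hXE⟩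
    have hx : jetProjection K E hkk₀ x = 0 := by
      rw [jetProjection_mk K E hkk₀ hXE]
      apply Subtype.ext
      ext i j
      exact Ideal.Quotient.eq_zero_iff_mem.mpr (hX i j)
    have hsurj : Function.Surjective (jetProjection K E hkk₀) := by
      rintro ⟨_, B, hB, rfl⟩
      exact ⟨_, jetProjection_mk K E hkk₀ hB⟩
    let T : Set (E.map (matrixJet K m n k₀)) := {y | ∃ B ∈ E,
      B ∈ {B | ¬ IsFinitelyDetermined GrEquiv (A + B)} ∧ matrixJet K m n k₀ B = y}
    refine le_trans ?_ (zariskiCodim_add_one_le_of_rank (T := T) (jetProjection K E hkk₀) hsurj hx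
      ?_ (jetMulVec K k A) Λ ?_)
    · rw [Nat.cast_add, Nat.cast_one]
      exact add_le_add_left (hk₀ k₀ le_rfl) 1
    · rintro _ ⟨B, hB, hBS, hBv⟩
      refine ⟨B, hB, hBS, ?_⟩
      rw [jetProjection, LinearMap.coe_restrict_apply, ← hBv]
      rfl
    · rintro v ⟨B, hB, hBS, hBv⟩
      have h1 : jetMulVec K k A + Λ v = jetMulVec K k (A + B) := by
        apply LinearMap.ext
        intro w
        have h2 : matrixJet K m n k (A + B) = matrixJet K m n k A + v.1 := by rw [map_add, hBv]
        simp only [jetMulVec, h2, LinearMap.add_apply, LinearMap.restrictScalars_apply,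
          Matrix.mulVecLin_apply, Matrix.add_mulVec]
        rfl
      have h3 := finrank_range_jetMulVec_add_le K hBS k
      have h4 := finrank_le_finrank_range_jetMulVec_add K hN hkN
      rw [h1]
      have h5 : Λ x = jetMulVec K k X := rfl
      rw [h5]
      omega

end jets

/-! ### Banded matrices built from parameters. -/

section banded

variable {R : Type*} [CommRing R]

/-- The banded matrix with entries `x (j - i)` for `i ≤ j`. -/
def bandedMatrix (m n : ℕ) (x : ℕ → R) : Matrix (Fin m) (Fin n) R :=
  Matrix.of fun i j => if (i : ℕ) ≤ j then x (j - i) else 0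

theorem mem_of_minorIdeal_bandedMatrix_le {m n : ℕ} {x : ℕ → R} {P : Ideal R}
    [hP : P.IsPrime] (h : minorIdeal (bandedMatrix m n x) ≤ P) (l : ℕ) (hl : l + m ≤ n) :
    x l ∈ P := by
  induction l using Nat.strong_induction_on with
  | _ l ih =>
    let f : Fin m → Fin n := fun i => ⟨i + l, by omega⟩
    have h1 := h (det_submatrix_mem_minorIdeal _ f)
    -- Modulo `P` the entries `x 0, …, x (l - 1)` vanish by induction, so the block starting at
    -- column `l` is upper triangular with determinant `x l ^ m`.
    rw [← Ideal.Quotient.eq_zero_iff_mem, RingHom.map_det, Matrix.det_of_isUpperTriangular] at h1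
    · simp only [RingHom.mapMatrix_apply, Matrix.map_apply, Matrix.submatrix_apply, id_eq,
        bandedMatrix, Matrix.of_apply, f, Nat.le_add_right, if_true, Nat.add_sub_cancel_left,
        Finset.prod_const] at h1
      rw [← map_pow, Ideal.Quotient.eq_zero_iff_mem] at h1
      exact hP.mem_of_pow_mem _ h1
    · intro i j hij
      have hij' : (j : ℕ) < i := hij
      simp only [RingHom.mapMatrix_apply, Matrix.map_apply, Matrix.submatrix_apply, id_eq,
        bandedMatrix, Matrix.of_apply, f]
      split_ifs with hle
      · exact Ideal.Quotient.eq_zero_iff_mem.mpr (ih _ (by omega) (by omega))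
      · exact map_zero _

/-- A set of at most `n - m + 1` elements over which `𝔪` is minimal fits on the diagonals of the
band; passing to powers raises the order of the entries without changing the primes that contain
them. -/
theorem exists_bandedMatrix_finite_colength [IsLocalRing R] [IsNoetherianRing R] {m n : ℕ}
    (hmn : m ≤ n) (hdim : ringKrullDim R ≤ (n - m + 1 : ℕ)) (s : ℕ) :
    ∃ X : Matrix (Fin m) (Fin n) R, (∀ i j, X i j ∈ maximalIdeal R ^ s) ∧
      ∃ N, ∀ v : Fin m → R, (∀ i, v i ∈ maximalIdeal R ^ N) → ∃ w, X *ᵥ w = v := by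
  classical
  obtain ⟨t, ht, hcard⟩ := (maximalIdeal R).exists_finset_card_eq_height_of_isNoetherianRing
  rw [← maximalIdeal_height_eq_ringKrullDim, ← hcard] at hdim
  have hcard' : t.card ≤ n - m + 1 := 
    Nat.cast_le.mp (WithBot.coe_le_coe.mp hdim)
  have htm : ∀ y ∈ t, y ∈ maximalIdeal R := fun y hy => ht.1.2 (Ideal.subset_span hy)
  -- Diagonals beyond the number of parameters are filled with the default value `0`.
  let y : ℕ → R := fun l => t.toList.getD l 0
  have hy : ∀ l, y l ∈ maximalIdeal R := by
    intro l
    by_cases hl : l < t.toList.length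
    · simp only [y, List.getD_eq_getElem _ _ hl]
      exact htm _ (Finset.mem_toList.mp (List.getElem_mem hl))
    · simp only [y, List.getD_eq_default _ _ (not_lt.mp hl)]
      exact Ideal.zero_mem _
  let X : Matrix (Fin m) (Fin n) R := bandedMatrix m n fun l => y l ^ (s + 1)
  have hXs : ∀ i j, X i j ∈ maximalIdeal R ^ s := by
    intro i j
    simp only [X, bandedMatrix, Matrix.of_apply]
    split_ifs
    · exact Ideal.pow_le_pow_right s.le_succ (Ideal.pow_mem_pow (hy _) _)
    · exact Ideal.zero_mem _
  obtain ⟨N, hN⟩ := exists_pow_le_of_forall_isPrime (I := minorIdeal X) fun P hP hXP => by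
    refine le_antisymm (le_maximalIdeal hP.ne_top) (ht.2 ⟨hP, ?_⟩ (le_maximalIdeal hP.ne_top))
    rw [Ideal.span_le]
    intro z hz
    obtain ⟨l, hl, rfl⟩ := List.getElem_of_mem (Finset.mem_toList.mpr hz)
    have hl' : l < t.card := by simpa using hl
    have := hP.mem_of_pow_mem _ (mem_of_minorIdeal_bandedMatrix_le hXP l (by omega))
    rw [SetLike.mem_coe]
    simpa only [y, List.getD_eq_getElem _ _ hl] using this
  exact ⟨X, hXs, N, fun v hv => exists_mulVec_eq_of_mem_minorIdeal X v fun i => hN (hv i)⟩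

end banded

theorem mainTheorem11 {𝕜 : Type*} [Field 𝕜] [CharZero 𝕜] {R : Type*} [CommRing R]
    [IsLocalRing R] [IsNoetherianRing R] [Algebra 𝕜 R] (hR : 0 < ringKrullDim R) :
    -- square matrices
    (∀ (m : ℕ) (A : Matrix (Fin m) (Fin m) R), 1 ≤ m →
      (∀ i j, A i j ∈ IsLocalRing.maximalIdeal R) →
        (IsFinitelyDetermined GlrEquiv A ↔
          ringKrullDim R = 1 ∧
            Ideal.Quotient.mk (nilradical R) A.det ∈ nonZeroDivisors (R ⧸ nilradical R)) ∧
        ((ringKrullDim R = 1 → ∃ x ∈ IsLocalRing.maximalIdeal R, x ∈ nonZeroDivisors R) →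
          (IsFinitelyDetermined GlrEquiv A ↔
            ringKrullDim R = 1 ∧ A.det ∈ nonZeroDivisors R))) ∧
    -- rings of large dimension
    (∀ (m n : ℕ), 1 ≤ m → 1 ≤ n →
      ((((n : ℤ) - (m : ℤ)).natAbs + 1 : ℕ) : WithBot ℕ∞) < ringKrullDim R →
        ∀ A : Matrix (Fin m) (Fin n) R, (∀ i j, A i j ∈ IsLocalRing.maximalIdeal R) →
          ¬ IsFinitelyDetermined GlrEquiv A) ∧
    -- genericity of finite determinacy for rings of small dimension
    (Module.Finite 𝕜 (IsLocalRing.ResidueField R) →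
      ∀ (m n : ℕ), 1 ≤ m → m ≤ n →
        ringKrullDim R ≤ ((((n : ℤ) - (m : ℤ)).natAbs + 1 : ℕ) : WithBot ℕ∞) →
          (∀ (A : Matrix (Fin m) (Fin n) R) (N : ℕ), 0 < N →
            HasInfiniteCodim 𝕜 (matricesIn 𝕜 m n (IsLocalRing.maximalIdeal R ^ N))
              {B | ¬ IsFinitelyDetermined GrEquiv (A + B)}) ∧
          HasInfiniteCodim 𝕜 (⊤ : Submodule 𝕜 (Matrix (Fin m) (Fin n) R))
            {A | ¬ IsFinitelyDetermined GrEquiv A}) ∧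
    -- two coprime maximal minors over rings of dimension two
    (ringKrullDim R = 2 →
      ∀ (m n : ℕ) (A : Matrix (Fin m) (Fin n) R) (e₁ e₂ : Fin m ↪o Fin n), 1 ≤ m → e₁ ≠ e₂ →
        ((∀ P : Ideal R, P.IsPrime → (A.submatrix id e₁).det ∈ P →
            (A.submatrix id e₂).det ∈ P → 2 ≤ P.height) →
          IsFinitelyDetermined GrEquiv A) ∧
        (UniqueFactorizationMonoid R →
          IsRelPrime (A.submatrix id e₁).det (A.submatrix id e₂).det →
            IsFinitelyDetermined GrEquiv A)) := by
  refine ⟨fun m A hm hA => ⟨?_, isFinitelyDetermined_square_iff_mem_nonZeroDivisors hR hm A hA⟩,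
    fun m n hm hn hdim A hA => not_isFinitelyDetermined_of_lt_ringKrullDim hm hn hdim A hA,
    fun hfin m n hm hmn hdim => ?_, fun h2 m n A e₁ e₂ hm he => ⟨?_, ?_⟩⟩
  · rw [mem_nonZeroDivisors_quotient_nilradical_iff]
    exact isFinitelyDetermined_square_iff hR hm A hA
  · have e : ((n : ℤ) - (m : ℤ)).natAbs = n - m := by omega
    rw [e] at hdim
    constructor
    · intro A N _
      refine hasInfiniteCodim_of_exists 𝕜 _ A fun s => ?_
      obtain ⟨X, hX, hcolength⟩ := exists_bandedMatrix_finite_colength hmn hdim (max s N)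
      exact ⟨X, fun i j => Ideal.pow_le_pow_right (le_max_right _ _) (hX i j),
        fun i j => Ideal.pow_le_pow_right (le_max_left _ _) (hX i j), hcolength⟩
    · have := hasInfiniteCodim_of_exists 𝕜 (⊤ : Submodule 𝕜 (Matrix (Fin m) (Fin n) R)) 0 fun s => by
        obtain ⟨X, hX, hcolength⟩ := exists_bandedMatrix_finite_colength hmn hdim s
        exact ⟨X, Submodule.mem_top, hX, hcolength⟩
      simpa only [zero_add] using this
  · exact isFinitelyDetermined_of_two_minors h2 A e₁ e₂
  · intro _ hrel
    exact isFinitelyDetermined_of_two_minors h2 A e₁ e₂ fun P _ ha hb =>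
      two_le_height_of_isRelPrime hrel P ha hb
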